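/- Let $F$ be the free group of rank $2$, $M=F/F''$, $\widehat M$ the profinite completion of $M$, $\widehat M'$ its closed commutator subgroup, $\widehat A=\widehat M/\widehat M'$ its abelianization, and $\widehat{\mathbb Z}[[\widehat A]]=\varprojlim_{n,U}(\mathbb Z/n)[\widehat A/U]$ ($n\ge 1$, $U$ open) the completed group ring, with augmentation $\epsilon:\widehat{\mathbb Z}[[\widehat A]]\to\widehat{\mathbb Z}$, $\epsilon(a)=1$ for $a\in\widehat A$. Let $\widehat{\mathbb Z}[[\widehat A]]^{\times'}$ be the group of units of augmentation $1$; it contains $\widehat A$. Conjugation makes the abelian group $\widehat M'$ a $\widehat{\mathbb Z}[[\widehat A]]$-module, whose action is written $m\mapsto m^r$. All homomorphisms are continuous; $\operatorname{Aut}$ carries the compact-open topology, and $\operatorname{Out}$ and $\operatorname{IOut}$ the induced quotient and subspace topologies. An IA-endomorphism of $\widehat M$ is an endomorphism inducing the identity on $\widehat A$, $\operatorname{IAut}(\widehat M)$ is the group of automorphisms of $\widehat M$ inducing the identity on $\widehat A$, $\operatorname{ab}_*:\operatorname{Out}(\widehat M)\to\operatorname{Aut}(\widehat A)$ is the natural map,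 and $\operatorname{IOut}(\widehat M)=\ker(\operatorname{ab}_*)$. Let $x_1,x_2$ be any pair of topological generators of $\widehat M$, with images $a_1,a_2\in\widehat A$, and write $[x_1,x_2]=x_1x_2x_1^{-1}x_2^{-1}$. (1) For every $r=(r_1,r_2)\in\widehat{\mathbb Z}[[\widehat A]]^2$ there is a unique endomorphism $\gamma_r$ of $\widehat M$ with $\gamma_r(x_i)=[x_1,x_2]^{r_i}x_i$ for $i=1,2$; it is an IA-endomorphism, and every IA-endomorphism of $\widehat M$ is $\gamma_r$ for a unique $r$. Moreover $\gamma_r$ is an inner automorphism if and only if its Bachmuth determinant $$\det(\gamma_r)=1+r_1(1-a_2)+r_2(a_1-1)$$ lies in $\widehat A\subset\widehat{\mathbb Z}[[\widehat A]]$. (2) For $\gamma_r\in\operatorname{IAut}(\widehat M)$ one has $\det(\gamma_r)\in\widehat{\mathbb Z}[[\widehat A]]^{\times'}$, and the determinant induces an isomorphism of topological groups $$\overline{\det}:\operatorname{IOut}(\widehat M)\xrightarrow{\ \sim\ }\widehat{\mathbb Z}[[\widehat A]]^{\times'}/\widehat A,$$ which does not depend on the choice of $x_1,x_2$. (3) The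 map $\operatorname{ab}_*$ is continuous, the basis $a_1,a_2$ identifies $\operatorname{Aut}(\widehat A)$ with $\operatorname{GL}_2(\widehat{\mathbb Z})$ as a topological group (the $j$-th column of the matrix of $\alpha$ being given by the exponents of $\alpha(a_j)$ in $a_1,a_2$), and the sequence $$1\to\widehat{\mathbb Z}[[\widehat A]]^{\times'}/\widehat A\xrightarrow{\ \overline{\det}^{-1}\ }\operatorname{Out}(\widehat M)\xrightarrow{\ \operatorname{ab}_*\ }\operatorname{GL}_2(\widehat{\mathbb Z})\to 1$$ is exact. -/

import Mathlib

open scoped commutatorElement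

noncomputable section

namespace ProMetabelian

/-! ### The ring of profinite integers -/

/-- The ring `Ẑ = lim ℤ/n`, as the ring of compatible families of residue classes. -/
def ZHat : Subring (∀ n : ℕ+, ZMod n) where
  carrier := {z | ∀ (m n : ℕ+) (h : (m : ℕ) ∣ n), ZMod.castHom h (ZMod m) (z n) = z m}
  mul_mem' := by
    intro a b ha hb m n h
    simp only [Pi.mul_apply, map_mul, ha m n h, hb m n h]
  one_mem' := by
    intro m n h
    simp only [Pi.one_apply, map_one]
  add_mem' := by
    intro a b ha hb m n h
    simp only [Pi.add_apply, map_add, ha m n h, hb m n h]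
  zero_mem' := by
    intro m n h
    simp only [Pi.zero_apply, map_zero]
  neg_mem' := by
    intro a ha m n h
    simp only [Pi.neg_apply, map_neg, ha m n h]

/-- The profinite topology: the subspace topology of the product of the discrete rings `ℤ/n`. -/
instance : TopologicalSpace ZHat := instTopologicalSpaceSubtype

/-! ### The completed group ring -/

section CompletedGroupRing

variable (G : Type*) [Group G] [TopologicalSpace G]

/-- The index set of the system of finite level group rings: pairs `(n, U)` with `n ≥ 1` and
`U` an open normal subgroup. -/
structure Level where
  n : ℕ+
  U : OpenNormalSubgroup G

variable {G}

/-- The group ring `(ℤ/n)[G/U]`. -/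
abbrev LevelRing (i : Level G) : Type _ := MonoidAlgebra (ZMod i.n) (G ⧸ i.U.toSubgroup)

/-- The natural map `(ℤ/n)[G/U] → (ℤ/m)[G/V]` for `m ∣ n` and `U ≤ V`. -/
def transition (i j : Level G) (hn : (j.n : ℕ) ∣ i.n)
    (hU : i.U.toSubgroup ≤ j.U.toSubgroup) : LevelRing i →+* LevelRing j :=
  (MonoidAlgebra.mapDomainRingHom (ZMod j.n)
    (QuotientGroup.map i.U.toSubgroup j.U.toSubgroup (MonoidHom.id G) hU)).comp
    (MonoidAlgebra.mapRingHom (G ⧸ i.U.toSubgroup) (ZMod.castHom hn (ZMod j.n)))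

variable (G) in
/-- The completed group ring `Ẑ[[G]] = lim (ℤ/n)[G/U]`, as the ring of compatible families. -/
def CompletedGroupRing : Subring (∀ i : Level G, LevelRing i) where
  carrier := {r | ∀ (i j : Level G) (hn : (j.n : ℕ) ∣ i.n)
    (hU : i.U.toSubgroup ≤ j.U.toSubgroup), transition i j hn hU (r i) = r j}
  mul_mem' := by
    intro a b ha hb i j hn hU
    simp only [Pi.mul_apply, map_mul, ha i j hn hU, hb i j hn hU]
  one_mem' := by
    intro i j hn hU
    simp only [Pi.one_apply, map_one]
  add_mem' := by
    intro a b ha hb i j hn hU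
    simp only [Pi.add_apply, map_add, ha i j hn hU, hb i j hn hU]
  zero_mem' := by
    intro i j hn hU
    simp only [Pi.zero_apply, map_zero]
  neg_mem' := by
    intro a ha i j hn hU
    simp only [Pi.neg_apply, map_neg, ha i j hn hU]

/-- The profinite topology: the subspace topology of the product of the discrete rings
`(ℤ/n)[G/U]`. -/
instance : TopologicalSpace (CompletedGroupRing G) :=
  TopologicalSpace.induced Subtype.val (Pi.topologicalSpace (t₂ := fun _ => ⊥))

instance (H : Type*) [CommGroup H] [TopologicalSpace H] : CommRing (CompletedGroupRing H) :=
  { (inferInstance : Ring (CompletedGroupRing H)) with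
    mul_comm := by
      intro a b
      apply Subtype.ext; funext i
      exact mul_comm (G := MonoidAlgebra (ZMod i.n) (H ⧸ i.U.toSubgroup)) (a.1 i) (b.1 i) }

/-- The inclusion of group elements `G → Ẑ[[G]]`. -/
def of : G →* CompletedGroupRing G where
  toFun g := ⟨fun i => MonoidAlgebra.single (QuotientGroup.mk g) 1, by
    intro i j hn hU
    simp only [transition, RingHom.comp_apply, MonoidAlgebra.mapRingHom_single, map_one]
    exact MonoidAlgebra.mapDomain_single⟩
  map_one' := by
    apply Subtype.ext; funext i; rfl
  map_mul' a b := by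
    apply Subtype.ext; funext i
    simp [MonoidAlgebra.single_mul_single]

/-- The augmentation `(ℤ/n)[G/U] → ℤ/n`, sending every group element to `1`. -/
def levelAug (i : Level G) : LevelRing i →+* ZMod i.n :=
  (MonoidAlgebra.lift (ZMod i.n) (ZMod i.n) (G ⧸ i.U.toSubgroup) 1).toRingHom

theorem levelAug_transition (i j : Level G) (hn : (j.n : ℕ) ∣ i.n)
    (hU : i.U.toSubgroup ≤ j.U.toSubgroup) (x : LevelRing i) :
    levelAug j (transition i j hn hU x) = ZMod.castHom hn (ZMod j.n) (levelAug i x) := by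
  have : (levelAug j).comp (transition i j hn hU) =
      (ZMod.castHom hn (ZMod j.n)).comp (levelAug i) := by
    apply MonoidAlgebra.ringHom_ext
    · intro r; simp [levelAug, transition]
    · intro r; simp [levelAug, transition]
  exact congrArg (fun f => f x) this

variable (G) in
/-- The level `(n, G)`. -/
def topLevel (n : ℕ+) : Level G :=
  ⟨n, ⟨⊤, inferInstanceAs (⊤ : Subgroup G).Normal⟩⟩

/-- The augmentation `Ẑ[[G]] → Ẑ`, sending every group element to `1`; its component at `n` is
the augmentation of the component at level `(n, G)`. -/
def aug : CompletedGroupRing G →+* ZHat where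
  toFun r := ⟨fun n => levelAug (topLevel G n) (r.1 (topLevel G n)), by
    intro m n h
    have := levelAug_transition (topLevel G n) (topLevel G m) h le_rfl (r.1 (topLevel G n))
    exact this.symm.trans
      (congrArg (levelAug (topLevel G m)) (r.2 (topLevel G n) (topLevel G m) h le_rfl))⟩
  map_one' := by
    apply Subtype.ext; funext n; exact map_one (levelAug (topLevel G n))
  map_mul' a b := by
    apply Subtype.ext; funext n; exact map_mul (levelAug (topLevel G n)) _ _
  map_zero' := by
    apply Subtype.ext; funext n; exact map_zero (levelAug (topLevel G n))
  map_add' a b := by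
    apply Subtype.ext; funext n; exact map_add (levelAug (topLevel G n)) _ _

theorem aug_of (g : G) : aug (of g) = 1 := by
  apply Subtype.ext; funext n
  simp [aug, of, levelAug]
  rfl

variable (G) in
/-- The group of special units: the units of `Ẑ[[G]]` of augmentation `1`. -/
def SpecialUnits : Subgroup (CompletedGroupRing G)ˣ :=
  (Units.map (aug (G := G)).toMonoidHom).ker

/-- The inclusion of group elements into the special units. -/
def ofSpecial : G →* SpecialUnits G where
  toFun g := ⟨(Units.map of) (toUnits g), by
    rw [SpecialUnits, MonoidHom.mem_ker]
    exact Units.ext (aug_of g)⟩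
  map_one' := by simp
  map_mul' a b := by simp

/-- The quotient of the group of special units of `Ẑ[[H]]` by `H`, for `H` commutative. -/
def SpecialUnitsMod (H : Type*) [CommGroup H] [TopologicalSpace H] : Type _ :=
  SpecialUnits H ⧸ (ofSpecial (G := H)).range

namespace SpecialUnitsMod

variable (H : Type*) [CommGroup H] [TopologicalSpace H]

instance : CommGroup (CompletedGroupRing H)ˣ := Units.instCommGroupUnits
instance : CommGroup (SpecialUnits H) := Subgroup.toCommGroup _
instance : (ofSpecial (G := H)).range.Normal := Subgroup.normal_of_isMulCommutative _
instance : CommGroup (SpecialUnitsMod H) :=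
  inferInstanceAs (CommGroup (SpecialUnits H ⧸ (ofSpecial (G := H)).range))
instance : TopologicalSpace (SpecialUnitsMod H) :=
  inferInstanceAs (TopologicalSpace (SpecialUnits H ⧸ (ofSpecial (G := H)).range))

variable {H} in
/-- The quotient map. -/
def mk : SpecialUnits H →* SpecialUnitsMod H := QuotientGroup.mk' (ofSpecial (G := H)).range

end SpecialUnitsMod

end CompletedGroupRing

/-! ### Profinite modules over the completed group ring

A profinite abelian group `V` with a continuous action of a compact group `G` is a module over
`Ẑ[[G]]`: modulo an open `G`-stable subgroup `W`, an element `r` acts through any lift to `ℤ[G]` of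
its component at any level `(n, U)` such that `n` kills `V/W` and `U` acts trivially on `V/W`. -/

section ProfiniteModule

variable {G : Type*} [Group G] [TopologicalSpace G] {V : Type*} [AddCommGroup V]
  [DistribMulAction G V]

/-- The action of the integral group ring `ℤ[G]` on `V`. -/
def intAct : MonoidAlgebra ℤ G →+* Module.End ℤ V :=
  (MonoidAlgebra.lift ℤ (Module.End ℤ V) G (DistribMulAction.toModuleEnd ℤ V)).toRingHom

/-- The reduction map `ℤ[G] → (ℤ/n)[G/U]`. -/
def intRed (i : Level G) : MonoidAlgebra ℤ G →+* LevelRing i :=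
  (MonoidAlgebra.mapDomainRingHom (ZMod i.n) (QuotientGroup.mk' i.U.toSubgroup)).comp
    (MonoidAlgebra.mapRingHom G (Int.castRingHom (ZMod i.n)))

/-- `n` kills `V/W` and `U` acts trivially on `V/W`. -/
def Adapted (i : Level G) (W : AddSubgroup V) : Prop :=
  (∀ v : V, (i.n : ℕ) • v ∈ W) ∧ ∀ g ∈ i.U, ∀ v : V, g • v - v ∈ W

/-- `W` is stable under the action of `G`. -/
def Stable (G : Type*) [Group G] [DistribMulAction G V] (W : AddSubgroup V) : Prop :=
  ∀ (g : G), ∀ v ∈ W, g • v ∈ W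

theorem intAct_single (g : G) (c : ℤ) (v : V) :
    intAct (MonoidAlgebra.single g c) v = c • (g • v) := by
  simp [intAct]

theorem intRed_single (i : Level G) (g : G) (c : ℤ) :
    intRed i (MonoidAlgebra.single g c) =
      MonoidAlgebra.single (QuotientGroup.mk g) (c : ZMod i.n) := by
  simp only [intRed, RingHom.comp_apply, MonoidAlgebra.mapRingHom_single]
  exact MonoidAlgebra.mapDomain_single

theorem transition_intRed (i j : Level G) (hn : (j.n : ℕ) ∣ i.n)
    (hU : i.U.toSubgroup ≤ j.U.toSubgroup) (s : MonoidAlgebra ℤ G) :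
    transition i j hn hU (intRed i s) = intRed j s := by
  induction s using MonoidAlgebra.induction_linear with
  | zero => simp
  | add f g hf hg => simp only [map_add, hf, hg]
  | single g c =>
    rw [intRed_single, intRed_single]
    simp only [transition, RingHom.comp_apply, MonoidAlgebra.mapRingHom_single, map_intCast]
    exact MonoidAlgebra.mapDomain_single

theorem intRed_surjective (i : Level G) : Function.Surjective (intRed i) := by
  intro x
  induction x using MonoidAlgebra.induction_linear with
  | zero => exact ⟨0, map_zero _⟩
  | add f g hf hg =>
    obtain ⟨a, rfl⟩ := hf
    obtain ⟨b, rfl⟩ := hg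
    exact ⟨a + b, map_add _ _ _⟩
  | single q c =>
    obtain ⟨g, rfl⟩ := QuotientGroup.mk_surjective q
    obtain ⟨z, rfl⟩ := ZMod.intCast_surjective c
    exact ⟨MonoidAlgebra.single g z, intRed_single i g z⟩

theorem intAct_mem_of_stable {W : AddSubgroup V} (hW : Stable G W) (s : MonoidAlgebra ℤ G)
    {v : V} (hv : v ∈ W) : intAct s v ∈ W := by
  induction s using MonoidAlgebra.induction_linear with
  | zero => simp
  | add f g hf hg =>
    rw [map_add]
    exact W.add_mem hf hg
  | single g c =>
    rw [intAct_single]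
    exact W.zsmul_mem (hW g v hv) c

/-- At a level adapted to `W`, the action of `ℤ[G]` on `V/W` factors through `(ℤ/n)[G/U]`. -/
theorem intAct_mem_of_intRed_eq_zero {W : AddSubgroup V} {i : Level G}
    (hi : Adapted i W) (v : V) (s : MonoidAlgebra ℤ G) (hs : intRed i s = 0) :
    intAct s v ∈ W := by
  have hsub : ∀ g h : G, (QuotientGroup.mk g : G ⧸ i.U.toSubgroup) = QuotientGroup.mk h →
      ((g • v : V) : V ⧸ W) = ((h • v : V) : V ⧸ W) := by
    intro g h hgh
    rw [QuotientAddGroup.eq]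
    have hu : g * h⁻¹ ∈ i.U := by
      have h1 : g⁻¹ * h ∈ i.U.toSubgroup := QuotientGroup.eq.mp hgh
      have h2 := i.U.toSubgroup.inv_mem (Subgroup.Normal.mem_comm inferInstance h1)
      rwa [mul_inv_rev, inv_inv] at h2
    have := hi.2 _ hu (h • v)
    rw [← W.neg_mem_iff]
    rw [mul_smul, inv_smul_smul] at this
    convert this using 1
    abel
  let f : G ⧸ i.U.toSubgroup → V ⧸ W := Quotient.lift (fun g : G => ((g • v : V) : V ⧸ W))
    (fun a b hab => hsub a b (Quotient.sound hab))
  have hf : ∀ g : G, f (QuotientGroup.mk g) = ((g • v : V) : V ⧸ W) := fun g => rfl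
  have hn : ∀ q : G ⧸ i.U.toSubgroup, ((i.n : ℕ) : ℤ) • f q = 0 := by
    intro q
    obtain ⟨g, rfl⟩ := QuotientGroup.mk_surjective q
    rw [hf, natCast_zsmul, ← QuotientAddGroup.mk_nsmul]
    exact (QuotientAddGroup.eq_zero_iff _).mpr (hi.1 _)
  let F : G ⧸ i.U.toSubgroup → (ZMod i.n →+ V ⧸ W) := fun q =>
    ZMod.lift (i.n : ℕ) ⟨zmultiplesHom (V ⧸ W) (f q), by
      rw [zmultiplesHom_apply]; exact hn q⟩
  let ψ : LevelRing i →+ V ⧸ W :=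
    { toFun := fun x => Finsupp.liftAddHom F x.coeff
      map_zero' := by rw [MonoidAlgebra.coeff_zero, map_zero]
      map_add' := fun x y => by rw [MonoidAlgebra.coeff_add, map_add] }
  have key : ∀ t : MonoidAlgebra ℤ G, ψ (intRed i t) = ((intAct t v : V) : V ⧸ W) := by
    intro t
    induction t using MonoidAlgebra.induction_linear with
    | zero => simp
    | add a b ha hb =>
      rw [map_add, map_add, ha, hb, map_add, LinearMap.add_apply, QuotientAddGroup.mk_add]
    | single g c =>
      rw [intRed_single, intAct_single, QuotientAddGroup.mk_zsmul, ← hf]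
      simp [ψ, F]
  have := key s
  rw [hs, map_zero] at this
  exact (QuotientAddGroup.eq_zero_iff _).mp this.symm

/-- The components of `r` at two levels adapted to `W` act in the same way on `V/W`. -/
theorem intAct_sub_mem {W : AddSubgroup V} {i j : Level G} (hi : Adapted i W) (hj : Adapted j W)
    (r : CompletedGroupRing G) (v : V) {s t : MonoidAlgebra ℤ G} (hs : intRed i s = r.1 i)
    (ht : intRed j t = r.1 j) : intAct s v - intAct t v ∈ W := by
  let k : Level G := ⟨i.n * j.n, i.U ⊓ j.U⟩
  obtain ⟨w, hw⟩ := intRed_surjective k (r.1 k)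
  have aux : ∀ l : Level G, Adapted l W → (l.n : ℕ) ∣ k.n → k.U.toSubgroup ≤ l.U.toSubgroup →
      ∀ a : MonoidAlgebra ℤ G, intRed l a = r.1 l → intAct (w - a) v ∈ W := by
    intro l hl hn hU a ha
    apply intAct_mem_of_intRed_eq_zero hl
    rw [map_sub, ← transition_intRed k l hn hU, hw, r.2 k l hn hU, ha, sub_self]
  have h1 := aux i hi (by simp [k]) (fun x hx => hx.1) s hs
  have h2 := aux j hj (by simp [k]) (fun x hx => hx.2) t ht
  have := W.sub_mem h2 h1
  rw [map_sub, map_sub, LinearMap.sub_apply, LinearMap.sub_apply] at this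
  convert this using 1
  abel

variable [TopologicalSpace V]

/-- `y` is the result of acting by `r` on `v`: modulo every open `G`-stable subgroup `W`, `y` agrees
with `s • v` for every lift `s` to `ℤ[G]` of a component of `r` at a level adapted to `W`. -/
def IsAct (r : CompletedGroupRing G) (v y : V) : Prop :=
  ∀ W : AddSubgroup V, IsOpen (W : Set V) → Stable G W → ∀ i : Level G, Adapted i W →
    ∀ s : MonoidAlgebra ℤ G, intRed i s = r.1 i → y - intAct s v ∈ W

variable [IsTopologicalGroup G] [CompactSpace G] [IsTopologicalAddGroup V] [CompactSpace V]
  [ContinuousSMul G V]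

theorem exists_adapted (W : AddSubgroup V) (hW : IsOpen (W : Set V)) (hs : Stable G W) :
    ∃ i : Level G, Adapted i W := by
  have hfin : Finite (V ⧸ W) := AddSubgroup.quotient_finite_of_isOpen W hW
  let U : Subgroup G :=
    { carrier := {g | ∀ v : V, g • v - v ∈ W}
      one_mem' := by intro v; simp
      mul_mem' := by
        intro a b ha hb v
        rw [mul_smul]
        have := W.add_mem (ha (b • v)) (hb v)
        simpa using this
      inv_mem' := by
        intro a ha v
        have := W.neg_mem (ha (a⁻¹ • v))
        simpa using this }
  have hn : U.Normal := ⟨by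
    intro a ha g v
    have := hs g _ (ha (g⁻¹ • v))
    rw [smul_sub, smul_inv_smul] at this
    rwa [mul_smul, mul_smul]⟩
  have hopen : IsOpen (U : Set G) := by
    apply Subgroup.isOpen_of_mem_nhds (g := 1)
    have hcont : Continuous (fun p : G × V => p.1 • p.2 - p.2) := by fun_prop
    obtain ⟨A, B, hA, -, h1, hB, hAB⟩ := generalized_tube_lemma (s := ({1} : Set G))
      isCompact_singleton (t := (Set.univ : Set V)) isCompact_univ (hW.preimage hcont) (by
        rintro ⟨g, v⟩ ⟨hg, -⟩
        have : g = 1 := hg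
        simp [this])
    refine Filter.mem_of_superset (hA.mem_nhds (h1 rfl)) ?_
    intro g hg v
    exact hAB (show (g, v) ∈ A ×ˢ B from ⟨hg, hB trivial⟩)
  refine ⟨⟨⟨Nat.card (V ⧸ W), Nat.card_pos⟩, ⟨⟨U, hopen⟩, hn⟩⟩, ?_, fun g hg => hg⟩
  intro v
  rw [← QuotientAddGroup.eq_zero_iff, QuotientAddGroup.mk_nsmul]
  exact card_nsmul_eq_zero'

variable [TotallyDisconnectedSpace V]

/-- The open `G`-stable subgroups separate the points of `V`. -/
theorem eq_zero_of_forall_stable (v : V)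
    (h : ∀ W : AddSubgroup V, IsOpen (W : Set V) → Stable G W → v ∈ W) : v = 0 := by
  by_contra hv
  have hT : T1Space V := inferInstance
  obtain ⟨H, hH⟩ := ProfiniteGrp.exist_openNormalAddSubgroup_sub_open_nhds_of_zero
    (U := ({v}ᶜ : Set V)) isOpen_compl_singleton (fun h0 => hv h0.symm)
  let W : AddSubgroup V :=
    { carrier := {w | ∀ g : G, g • w ∈ H}
      zero_mem' := by intro g; rw [smul_zero]; exact zero_mem H
      add_mem' := by intro a b ha hb g; rw [smul_add]; exact add_mem (ha g) (hb g)
      neg_mem' := by intro a ha g; rw [smul_neg]; exact neg_mem (ha g) }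
  have hopen : IsOpen (W : Set V) := by
    apply AddSubgroup.isOpen_of_mem_nhds (g := 0)
    have hcont : Continuous (fun p : G × V => p.1 • p.2) := continuous_smul
    obtain ⟨A, B, -, hB, hA, h0, hAB⟩ := generalized_tube_lemma (s := (Set.univ : Set G))
      isCompact_univ (t := ({0} : Set V)) isCompact_singleton
      (H.toOpenAddSubgroup.isOpen.preimage hcont) (by
        rintro ⟨g, w⟩ ⟨-, hw⟩
        have : w = 0 := hw
        subst this
        show g • (0 : V) ∈ H
        rw [smul_zero]; exact zero_mem H)
    refine Filter.mem_of_superset (hB.mem_nhds (h0 rfl)) ?_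
    intro w hw g
    exact hAB (show (g, w) ∈ A ×ˢ B from ⟨hA trivial, hw⟩)
  have := h W hopen (by
    intro g w hw k
    rw [← mul_smul]; exact hw _) 1
  rw [one_smul] at this
  exact hH this rfl

theorem IsAct.unique {r : CompletedGroupRing G} {v y z : V} (hy : IsAct r v y)
    (hz : IsAct r v z) : y = z := by
  rw [← sub_eq_zero]
  apply eq_zero_of_forall_stable (G := G)
  intro W hW hs
  obtain ⟨i, hi⟩ := exists_adapted (G := G) W hW hs
  obtain ⟨s, hs'⟩ := intRed_surjective i (r.1 i)
  have := W.sub_mem (hy W hW hs i hi s hs') (hz W hW hs i hi s hs')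
  simpa using this

theorem exists_isAct (r : CompletedGroupRing G) (v : V) : ∃ y, IsAct r v y := by
  let I := {W : AddSubgroup V // IsOpen (W : Set V) ∧ Stable G W}
  choose lev hlev using fun W : I => exists_adapted (G := G) W.1 W.2.1 W.2.2
  choose s hs using fun W : I => intRed_surjective (lev W) (r.1 (lev W))
  let C : I → Set V := fun W => {y | y - intAct (s W) v ∈ W.1}
  have hclosed : ∀ W, IsClosed (C W) := fun W =>
    (AddSubgroup.isClosed_of_isOpen W.1 W.2.1).preimage
      (by fun_prop : Continuous fun y : V => y - intAct (s W) v)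
  have : Nonempty I := ⟨⟨⊤, isOpen_univ, fun _ _ _ => trivial⟩⟩
  have hadapt : ∀ {i : Level G} {W W' : AddSubgroup V}, W ≤ W' → Adapted i W → Adapted i W' :=
    fun h hi => ⟨fun v => h (hi.1 v), fun g hg v => h (hi.2 g hg v)⟩
  have hdir : Directed (· ⊇ ·) C := by
    intro W W'
    let W'' : I := ⟨W.1 ⊓ W'.1, W.2.1.inter W'.2.1,
      fun g w hw => ⟨W.2.2 g w hw.1, W'.2.2 g w hw.2⟩⟩
    have aux : ∀ X : I, W''.1 ≤ X.1 → C W'' ⊆ C X := by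
      intro X hX y hy
      have h1 := intAct_sub_mem (hadapt hX (hlev W'')) (hlev X) r v (hs W'') (hs X)
      have := X.1.add_mem (hX hy) h1
      simpa [C] using this
    exact ⟨W'', aux W inf_le_left, aux W' inf_le_right⟩
  obtain ⟨y, hy⟩ := IsCompact.nonempty_iInter_of_directed_nonempty_isCompact_isClosed C hdir
    (fun W => ⟨intAct (s W) v, by simp [C]⟩) (fun W => (hclosed W).isCompact) hclosed
  refine ⟨y, fun W hW hst i hi t ht => ?_⟩
  have h1 := Set.mem_iInter.mp hy ⟨W, hW, hst⟩
  have h2 := intAct_sub_mem (hlev ⟨W, hW, hst⟩) hi r v (hs _) ht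
  have := W.add_mem h1 h2
  simpa using this

/-- The action of `r ∈ Ẑ[[G]]` on `v`. -/
def act (r : CompletedGroupRing G) (v : V) : V := (exists_isAct r v).choose

theorem isAct_act (r : CompletedGroupRing G) (v : V) : IsAct r v (act r v) :=
  (exists_isAct r v).choose_spec

theorem act_eq_iff {r : CompletedGroupRing G} {v y : V} : act r v = y ↔ IsAct r v y :=
  ⟨fun h => h ▸ isAct_act r v, fun h => (isAct_act r v).unique h⟩

/-- The `Ẑ[[G]]`-module structure of a profinite abelian group with continuous `G`-action. -/
@[reducible] def completedModule : Module (CompletedGroupRing G) V where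
  smul r v := act r v
  one_smul v := act_eq_iff.mpr (by
    intro W hW hst i hi s hs
    have h := intAct_mem_of_intRed_eq_zero hi v (1 - s) (by
      rw [map_sub, map_one, hs]; exact sub_self _)
    simpa using h)
  mul_smul a b v := act_eq_iff.mpr (by
    intro W hW hst i hi s hs
    obtain ⟨t, ht⟩ := intRed_surjective i (a.1 i)
    obtain ⟨u, hu⟩ := intRed_surjective i (b.1 i)
    have h1 := isAct_act a (act b v) W hW hst i hi t ht
    have h2 := intAct_mem_of_stable hst t (isAct_act b v W hW hst i hi u hu)
    have h3 := intAct_mem_of_intRed_eq_zero hi v (t * u - s) (by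
      rw [map_sub, map_mul, hs, ht, hu]; exact sub_self _)
    have := W.add_mem (W.add_mem h1 h2) h3
    change act a (act b v) - intAct s v ∈ W
    simpa using this)
  smul_zero a := act_eq_iff.mpr (by
    intro W hW hst i hi s hs
    simp)
  smul_add a v w := act_eq_iff.mpr (by
    intro W hW hst i hi s hs
    have := W.add_mem (isAct_act a v W hW hst i hi s hs) (isAct_act a w W hW hst i hi s hs)
    rw [map_add]
    change act a v + act a w - _ ∈ W
    convert this using 1
    abel)
  add_smul a b v := act_eq_iff.mpr (by
    intro W hW hst i hi s hs
    obtain ⟨t, ht⟩ := intRed_surjective i (a.1 i)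
    obtain ⟨u, hu⟩ := intRed_surjective i (b.1 i)
    have h1 := isAct_act a v W hW hst i hi t ht
    have h2 := isAct_act b v W hW hst i hi u hu
    have h3 := intAct_mem_of_intRed_eq_zero hi v (t + u - s) (by
      rw [map_sub, map_add, hs, ht, hu]; exact sub_self _)
    have := W.add_mem (W.add_mem h1 h2) h3
    rw [map_sub, map_add, LinearMap.sub_apply, LinearMap.add_apply] at this
    change act a v + act b v - _ ∈ W
    convert this using 1
    abel)
  zero_smul v := act_eq_iff.mpr (by
    intro W hW hst i hi s hs
    have := intAct_mem_of_intRed_eq_zero hi v s hs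
    simpa using this)

/-- Group elements act through the given action. -/
theorem act_of (g : G) (v : V) : act (of g : CompletedGroupRing G) v = g • v :=
  act_eq_iff.mpr (by
    intro W hW hst i hi s hs
    have h := intAct_mem_of_intRed_eq_zero hi v (MonoidAlgebra.single g 1 - s) (by
      rw [map_sub, intRed_single, hs, Int.cast_one]; exact sub_self _)
    rw [map_sub, LinearMap.sub_apply, intAct_single, one_smul] at h
    exact h)

end ProfiniteModule

/-! ### Automorphisms of topological groups -/

section Automorphisms

/-- The group of automorphisms of a topological group (bicontinuous group automorphisms). -/
def ContAut (G : Type*) [Group G] [TopologicalSpace G] : Type _ := G ≃ₜ* G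

variable {G : Type*} [Group G] [TopologicalSpace G]

namespace ContAut

instance : EquivLike (ContAut G) G G := inferInstanceAs (EquivLike (G ≃ₜ* G) G G)
instance : MulEquivClass (ContAut G) G G := inferInstanceAs (MulEquivClass (G ≃ₜ* G) G G)
instance : HomeomorphClass (ContAut G) G G := inferInstanceAs (HomeomorphClass (G ≃ₜ* G) G G)

@[ext] theorem ext {f g : ContAut G} (h : ∀ x, f x = g x) : f = g := DFunLike.ext f g h

/-- The group law is composition: `(f * g) x = f (g x)`. -/
instance : Group (ContAut G) where
  mul f g := ContinuousMulEquiv.trans g f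
  one := ContinuousMulEquiv.refl G
  inv f := ContinuousMulEquiv.symm f
  mul_assoc _ _ _ := rfl
  one_mul _ := rfl
  mul_one _ := rfl
  inv_mul_cancel f := ContAut.ext fun x => ContinuousMulEquiv.symm_apply_apply f x

theorem mul_apply (f g : ContAut G) (x : G) : (f * g) x = f (g x) := rfl
theorem one_apply (x : G) : (1 : ContAut G) x = x := rfl

theorem continuous (f : ContAut G) : Continuous f := map_continuous f

/-- The compact-open topology. -/
instance : TopologicalSpace (ContAut G) :=
  TopologicalSpace.induced (fun f => (⟨f, f.continuous⟩ : C(G, G))) inferInstance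

/-- The underlying continuous endomorphism. -/
def toEnd (f : ContAut G) : G →ₜ* G := ⟨MulEquivClass.toMulEquiv f, f.continuous⟩

end ContAut

variable [IsTopologicalGroup G]

variable (G) in
/-- The homomorphism sending `g` to conjugation by `g`, that is `x ↦ g x g⁻¹`. -/
def conj : G →* ContAut G where
  toFun g := (⟨MulAut.conj g, by
    change Continuous fun x => g * x * g⁻¹
    fun_prop, by
    change Continuous fun x => g⁻¹ * x * g
    fun_prop⟩ : G ≃ₜ* G)
  map_one' := ContAut.ext fun x => by
    change 1 * x * 1⁻¹ = x
    simp
  map_mul' a b := ContAut.ext fun x => by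
    change (a * b) * x * (a * b)⁻¹ = a * (b * x * b⁻¹) * a⁻¹
    group

theorem conj_apply (g x : G) : conj G g x = g * x * g⁻¹ := rfl

variable (G) in
/-- The group of inner automorphisms. -/
def Inn : Subgroup (ContAut G) := (conj G).range

instance : (Inn G).Normal := ⟨by
  rintro _ ⟨g, rfl⟩ f
  refine ⟨f g, ContAut.ext fun x => ?_⟩
  have hx : f (f⁻¹ x) = x := ContinuousMulEquiv.apply_symm_apply f x
  change f g * x * (f g)⁻¹ = f (g * f⁻¹ x * g⁻¹)
  rw [map_mul, map_mul, map_inv, hx]⟩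

variable (G) in
/-- The group of outer automorphisms, with the quotient topology. -/
abbrev Out : Type _ := ContAut G ⧸ Inn G

theorem map_commutator_closure (f : G →ₜ* G) {x : G}
    (hx : x ∈ (commutator G).topologicalClosure) :
    f x ∈ (commutator G).topologicalClosure := by
  have h1 : Set.MapsTo f (commutator G : Set G) (commutator G : Set G) := by
    intro y hy
    have : (commutator G).map f.toMonoidHom ≤ commutator G := by
      rw [commutator_def, Subgroup.map_commutator]
      exact Subgroup.commutator_mono le_top le_top
    exact this ⟨y, hy, rfl⟩
  exact h1.closure f.continuous_toFun hx

/-- The endomorphism of the topological abelianization induced by an endomorphism. -/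
def abEnd (f : G →ₜ* G) : TopologicalAbelianization G →* TopologicalAbelianization G :=
  QuotientGroup.map _ _ f.toMonoidHom fun _ hx => map_commutator_closure f hx

theorem abEnd_mk (f : G →ₜ* G) (x : G) :
    abEnd f (x : TopologicalAbelianization G) = ((f x : G) : TopologicalAbelianization G) := rfl

theorem continuous_abEnd (f : G →ₜ* G) : Continuous (abEnd f) :=
  continuous_quot_lift _ (continuous_quot_mk.comp f.continuous_toFun)

variable (G) in
/-- The action of automorphisms of `G` on the topological abelianization. -/
def abAut : ContAut G →* ContAut (TopologicalAbelianization G) where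
  toFun f :=
    ({ toFun := abEnd f.toEnd
       invFun := abEnd (f⁻¹).toEnd
       left_inv := by
         rintro ⟨x⟩
         exact congrArg QuotientGroup.mk (ContinuousMulEquiv.symm_apply_apply f x)
       right_inv := by
         rintro ⟨x⟩
         exact congrArg QuotientGroup.mk (ContinuousMulEquiv.apply_symm_apply f x)
       map_mul' := map_mul _
       continuous_toFun := continuous_abEnd _
       continuous_invFun := continuous_abEnd _ } :
      TopologicalAbelianization G ≃ₜ* TopologicalAbelianization G)
  map_one' := ContAut.ext fun x => by
    obtain ⟨x, rfl⟩ := QuotientGroup.mk_surjective x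
    rfl
  map_mul' f g := ContAut.ext fun x => by
    obtain ⟨x, rfl⟩ := QuotientGroup.mk_surjective x
    rfl

theorem abAut_mk (f : ContAut G) (x : G) :
    abAut G f (x : TopologicalAbelianization G) = ((f x : G) : TopologicalAbelianization G) := rfl

variable (G) in
/-- The map `ab_*` from outer automorphisms of `G` to automorphisms of the abelianization. -/
def abStar : Out G →* ContAut (TopologicalAbelianization G) :=
  QuotientGroup.lift (Inn G) (abAut G) (by
    rintro _ ⟨g, rfl⟩
    refine ContAut.ext fun x => ?_
    obtain ⟨x, rfl⟩ := QuotientGroup.mk_surjective x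
    rw [abAut_mk, conj_apply, ContAut.one_apply, QuotientGroup.mk_mul, QuotientGroup.mk_mul,
      QuotientGroup.mk_inv, mul_comm (g : TopologicalAbelianization G), mul_inv_cancel_right])

variable (G) in
/-- Outer automorphisms acting trivially on the abelianization. -/
def IOut : Subgroup (Out G) := (abStar G).ker

/-- IA-endomorphisms: those acting as the identity on the abelianization. -/
def IsIAEnd (f : G →ₜ* G) : Prop := abEnd f = MonoidHom.id (TopologicalAbelianization G)

/-- An endomorphism which is an inner automorphism. -/
def IsInner (f : G →ₜ* G) : Prop := ∃ g : G, f = (conj G g).toEnd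

/-- `x` generates `G` topologically. -/
def TopGenerates {ι : Type*} (x : ι → G) : Prop :=
  (Subgroup.closure (Set.range x)).topologicalClosure = ⊤

end Automorphisms

/-! ### Abelianizations of profinite groups -/

instance {G : Type*} [Group G] [TopologicalSpace G] [IsTopologicalGroup G] [CompactSpace G]
    [TotallyDisconnectedSpace G] : TotallyDisconnectedSpace (TopologicalAbelianization G) := by
  suffices h : TotallySeparatedSpace (TopologicalAbelianization G) from inferInstance
  refine totallySeparatedSpace_iff_exists_isClopen.mpr ?_
  intro a b hab
  let N : ClosedSubgroup G :=
    ⟨(commutator G).topologicalClosure, (commutator G).isClosed_topologicalClosure⟩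
  obtain ⟨a, rfl⟩ := QuotientGroup.mk_surjective a
  obtain ⟨b, rfl⟩ := QuotientGroup.mk_surjective b
  have hN : a⁻¹ * b ∉ N.toSubgroup := fun h => hab (QuotientGroup.eq.mpr h)
  have hN' : a⁻¹ * b ∉ sInf {K : Subgroup G | IsOpen (K : Set G) ∧ N.toSubgroup ≤ K} := by
    have := ProfiniteGrp.closedSubgroup_eq_sInf_open N
    exact fun h => hN (this ▸ h)
  simp only [Subgroup.mem_sInf, Set.mem_ofPred_eq, not_forall] at hN'
  obtain ⟨K, ⟨hK, hNK⟩, hx⟩ := hN'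
  have hcl : IsClosed (K : Set G) := K.isClosed_of_isOpen hK
  have hcoset : IsClopen ((fun g => a⁻¹ * g) ⁻¹' (K : Set G)) :=
    ⟨hcl.preimage (by fun_prop), hK.preimage (by fun_prop)⟩
  let S : Set (TopologicalAbelianization G) :=
    {q | ∃ g : G, (g : TopologicalAbelianization G) = q ∧ a⁻¹ * g ∈ K}
  have hS : (QuotientGroup.mk : G → TopologicalAbelianization G) ⁻¹' S =
      (fun g => a⁻¹ * g) ⁻¹' (K : Set G) := by
    ext g
    constructor
    · rintro ⟨h, hh, hk⟩
      have := K.mul_mem hk (hNK (QuotientGroup.eq.mp hh))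
      simpa [mul_assoc] using this
    · intro hg
      exact ⟨g, rfl, hg⟩
  refine ⟨S, ?_, ⟨a, rfl, by simp⟩, ?_⟩
  · rw [← (QuotientGroup.isOpenQuotientMap_mk (N := N.toSubgroup)).isQuotientMap.isClopen_preimage, hS]
    exact hcoset
  · intro hb
    have : b ∈ (QuotientGroup.mk : G → TopologicalAbelianization G) ⁻¹' S := hb
    rw [hS] at this
    exact hx this

/-- The trivial action of the trivial group. -/
@[reducible] def trivialAction (V : Type*) [AddCommGroup V] : DistribMulAction Unit V where
  smul _ v := v
  one_smul _ := rfl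
  mul_smul _ _ _ := rfl
  smul_zero _ := rfl
  smul_add _ _ _ := rfl

/-- The structure homomorphism `Ẑ → Ẑ[[G]]`. -/
def zHatToCompleted (G : Type*) [Group G] [TopologicalSpace G] :
    ZHat →+* CompletedGroupRing G where
  toFun z := ⟨fun i => MonoidAlgebra.single 1 (z.1 i.n), by
    intro i j hn hU
    simp only [transition, RingHom.comp_apply, MonoidAlgebra.mapRingHom_single]
    rw [z.2 _ _ hn]
    exact MonoidAlgebra.mapDomain_single⟩
  map_one' := by apply Subtype.ext; funext i; rfl
  map_mul' a b := by
    apply Subtype.ext; funext i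
    exact (MonoidAlgebra.singleOneRingHom (R := ZMod i.n) (M := G ⧸ i.U.toSubgroup)).map_mul _ _
  map_zero' := by apply Subtype.ext; funext i; exact MonoidAlgebra.single_zero _
  map_add' a b := by apply Subtype.ext; funext i; exact MonoidAlgebra.single_add _ _ _

/-- The power `a ^ z` of an element of a profinite abelian group, with exponent `z ∈ Ẑ`. -/
def zHatPow {A : Type*} [CommGroup A] [TopologicalSpace A] [IsTopologicalGroup A] [CompactSpace A]
    [TotallyDisconnectedSpace A] (a : A) (z : ZHat) : A :=
  letI := trivialAction (Additive A)
  haveI : ContinuousSMul Unit (Additive A) := ⟨continuous_snd⟩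
  Additive.toMul (act (zHatToCompleted Unit z) (Additive.ofMul a))

theorem zHatPow_intCast {A : Type*} [CommGroup A] [TopologicalSpace A] [IsTopologicalGroup A]
    [CompactSpace A] [TotallyDisconnectedSpace A] (a : A) (k : ℤ) :
    zHatPow a (k : ZHat) = a ^ k := by
  let := trivialAction (Additive A)
  have : ContinuousSMul Unit (Additive A) := ⟨continuous_snd⟩
  let := completedModule (G := Unit) (V := Additive A)
  have : (k : CompletedGroupRing Unit) • Additive.ofMul a = k • Additive.ofMul a :=
    Int.cast_smul_eq_zsmul _ _ _
  change Additive.toMul (zHatToCompleted Unit (k : ZHat) • Additive.ofMul a) = a ^ k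
  rw [map_intCast, this]
  rfl
/-! ### The free profinite metabelian group of rank two -/

section FreeMetabelian

/-- The free metabelian group `M = F/F''` of rank two. -/
abbrev FreeMetabelian : Type := FreeGroup (Fin 2) ⧸ derivedSeries (FreeGroup (Fin 2)) 2

/-- The profinite completion `M̂` of `M`. -/
abbrev MHat : Type := ProfiniteGrp.ProfiniteCompletion.completion (GrpCat.of FreeMetabelian)

/-- The abelianization `Â` of `M̂`. -/
abbrev AHat : Type := TopologicalAbelianization MHat

/-- The (closed) commutator subgroup `M̂'` of `M̂`. -/
abbrev Derived : Subgroup MHat := (commutator MHat).topologicalClosure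

/-- The projection of `M̂` to a finite quotient of `M`. -/
def proj (H : FiniteIndexNormalSubgroup FreeMetabelian) :
    MHat →* FreeMetabelian ⧸ H.toSubgroup where
  toFun x := x.1 H
  map_one' := rfl
  map_mul' _ _ := rfl

theorem derivedSeries_mHat : derivedSeries MHat 2 = ⊥ := by
  rw [eq_bot_iff]
  intro x hx
  have hM : derivedSeries FreeMetabelian 2 = ⊥ := by
    rw [← map_derivedSeries_eq
      (QuotientGroup.mk'_surjective (derivedSeries (FreeGroup (Fin 2)) 2)) 2]
    exact (Subgroup.map_eq_bot_iff _).mpr (by rw [QuotientGroup.ker_mk'])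
  have hQ : ∀ H : FiniteIndexNormalSubgroup FreeMetabelian,
      derivedSeries (FreeMetabelian ⧸ H.toSubgroup) 2 = ⊥ := by
    intro H
    rw [← map_derivedSeries_eq (QuotientGroup.mk'_surjective H.toSubgroup) 2, hM,
      Subgroup.map_bot]
  apply Subgroup.mem_bot.mpr
  apply Subtype.ext
  funext H
  have := map_derivedSeries_le_derivedSeries (proj H) 2 ⟨x, hx, rfl⟩
  rw [hQ H] at this
  exact Subgroup.mem_bot.mp this

theorem derived_comm (a b : MHat) (ha : a ∈ Derived) (hb : b ∈ Derived) : a * b = b * a := by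
  have h0 : ∀ a ∈ commutator MHat, ∀ b ∈ commutator MHat, a * b = b * a := by
    intro a ha b hb
    have h : ⁅commutator MHat, commutator MHat⁆ = ⊥ := by
      have h' := derivedSeries_succ MHat 1
      rw [derivedSeries_one] at h'
      exact h'.symm.trans derivedSeries_mHat
    have h2 : ⁅a, b⁆ = 1 := by
      have := Subgroup.commutator_mem_commutator ha hb
      rw [h] at this
      exact Subgroup.mem_bot.mp this
    exact commutatorElement_eq_one_iff_mul_comm.mp h2
  have h1 : ∀ a ∈ commutator MHat, ∀ b ∈ Derived, a * b = b * a := by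
    intro a ha b hb
    have hc : IsClosed {b : MHat | a * b = b * a} := isClosed_eq (by fun_prop) (by fun_prop)
    exact closure_minimal (fun b hb => h0 a ha b hb) hc hb
  have hc : IsClosed {a : MHat | a * b = b * a} := isClosed_eq (by fun_prop) (by fun_prop)
  exact closure_minimal (fun a ha => h1 a ha b hb) hc ha

/-- The conjugation action of `Â` on `M̂'`. -/
def conjAction : AHat →* MulAut Derived :=
  QuotientGroup.lift Derived (MulAut.conjNormal (H := Derived)) (by
    intro a ha
    ext b
    rw [MulAut.conjNormal_apply, derived_comm a b ha b.2, mul_inv_cancel_right]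
    rfl)

/-- The group `M̂'`, written additively. -/
def DerivedModule : Type := Additive Derived

namespace DerivedModule

instance : AddCommGroup DerivedModule :=
  { (inferInstanceAs (AddGroup (Additive Derived)) : AddGroup DerivedModule) with
    add_comm := fun a b => Subtype.ext (derived_comm _ _ a.2 b.2) }

instance : TopologicalSpace DerivedModule := inferInstanceAs (TopologicalSpace Derived)
instance : IsTopologicalAddGroup DerivedModule :=
  inferInstanceAs (IsTopologicalAddGroup (Additive Derived))
instance : CompactSpace DerivedModule :=
  isCompact_iff_compactSpace.mp (commutator MHat).isClosed_topologicalClosure.isCompact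
instance : TotallyDisconnectedSpace DerivedModule :=
  inferInstanceAs (TotallyDisconnectedSpace Derived)

/-- An element of `M̂'` as an element of the module. -/
def ofElem (m : Derived) : DerivedModule := Additive.ofMul m

/-- An element of the module as an element of `M̂`. -/
def toElem (m : DerivedModule) : MHat := (Additive.toMul (α := Derived) m : Derived)

instance : DistribMulAction AHat DerivedModule where
  smul a m := Additive.ofMul (conjAction a (Additive.toMul (α := Derived) m))
  one_smul m := by
    change Additive.ofMul (conjAction 1 _) = _
    rw [map_one]; rfl
  mul_smul a b m := by
    change Additive.ofMul (conjAction (a * b) _) = _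
    rw [map_mul]; rfl
  smul_zero a := congrArg Additive.ofMul (map_one (conjAction a))
  smul_add a m n := congrArg Additive.ofMul
    (map_mul (conjAction a) (Additive.toMul (α := Derived) m) (Additive.toMul (α := Derived) n))

theorem toElem_smul (g : MHat) (m : DerivedModule) :
    toElem ((g : AHat) • m) = g * toElem m * g⁻¹ := rfl

instance : ContinuousSMul AHat DerivedModule := by
  refine ⟨?_⟩
  have hq : IsOpenQuotientMap
      (Prod.map (QuotientGroup.mk : MHat → AHat) (id : DerivedModule → DerivedModule)) :=
    (QuotientGroup.isOpenQuotientMap_mk).prodMap IsOpenQuotientMap.id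
  rw [hq.isQuotientMap.continuous_iff]
  have hc : Continuous fun p : MHat × Derived => p.1 * (p.2 : MHat) * p.1⁻¹ := by fun_prop
  exact hc.subtype_mk (fun p =>
    (inferInstance : Derived.Normal).conj_mem _ p.2.2 p.1)

/-- The `Ẑ[[Â]]`-module structure of `M̂'`, extending the conjugation action of `Â`. -/
instance : Module (CompletedGroupRing AHat) DerivedModule := completedModule

end DerivedModule

/-- The commutator `[x, y] = x y x⁻¹ y⁻¹` as an element of `M̂'`. -/
def comm (x y : MHat) : DerivedModule :=
  DerivedModule.ofElem ⟨⁅x, y⁆, Subgroup.le_topologicalClosure _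
    (Subgroup.commutator_mem_commutator (Subgroup.mem_top x) (Subgroup.mem_top y))⟩

/-- `γ` is the endomorphism `γ_r` attached to a pair `x` and `r = (r₁, r₂)`: it maps `x_i` to
`[x₁, x₂] ^ {r_i} x_i`. -/
def IsGamma (x : Fin 2 → MHat) (r : Fin 2 → CompletedGroupRing AHat) (γ : MHat →ₜ* MHat) : Prop :=
  ∀ i, γ (x i) = (r i • comm (x 0) (x 1)).toElem * x i

/-- The Bachmuth determinant `1 + r₁ (1 - a₂) + r₂ (a₁ - 1)`, where `a_i` is the image of `x_i`. -/
def bachmuthDet (x : Fin 2 → MHat) (r : Fin 2 → CompletedGroupRing AHat) :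
    CompletedGroupRing AHat :=
  1 + r 0 * (1 - of (x 1 : AHat)) + r 1 * (of (x 0 : AHat) - 1)

end FreeMetabelian

end ProMetabelian

end

open ProMetabelian

/-!
Write `R = Ẑ[[Â]]`, let `x₀, x₁` be topological generators of `M̂` with images `a₀, a₁ ∈ Â`, and
let `c = [x₀, x₁]`.

Finitely generated profinite groups are Hopfian (`TopGenerates.injective_of_surjective`), so
`x₀, x₁` are free generators of `M̂` among profinite metabelian groups
(`TopGenerates.exists_hom`). The closed submodule `R • c` of `M̂'` is normal with abelian
quotient, hence equal to `M̂'`. It is free: mapping `M̂` to the finite metabelian groups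
`(ℤ/n)[Â/U] ⋊ Â/U` by `x₀ ↦ (0, a₀)`, `x₁ ↦ (1, a₁)` shows that `r • c = 0` implies
`r (a₀ - 1) = 0`, and `1 - a₀` is not a zero divisor of `R`, because at a finite level an element
invariant under `a₀` has coefficients constant on long orbits and so dies at coarser levels
(`level_eq_zero_of_invariant`). The same counting, on the levels at which `a₀` is trivial, shows
that `1 - a₀, 1 - a₁` is a regular sequence (`TopGenerates.koszul`); its input is that an element
of `R` which vanishes at all levels where `a` and `b` are trivial lies in the ideal
`(1 - a, 1 - b)`, by finite group rings and compactness (`exists_eq_of_forall_level_eq_zero`).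

Part (1) follows: IA-endomorphisms are given by the elements `γ(xᵢ) xᵢ⁻¹` of `M̂' = R • c`. An
IA-endomorphism `γ` is `R`-linear on `M̂'`, so it acts there by a scalar `iaDet γ`, and a
commutator computation identifies this scalar with the Bachmuth determinant. It is visibly
multiplicative and independent of the generators. Conjugation by `g` has determinant the image of
`g`, and an IA-endomorphism of determinant `1` is inner by the Koszul complex, so that `γ` is
inner if and only if `iaDet γ ∈ Â`.

For part (2), the augmentation ideal is generated by `1 - a₀, 1 - a₁`, so every unit of
augmentation `1` is a determinant, and an IA-endomorphism whose determinant is a unit is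
bijective. The automorphism group of `M̂` is compact, as endomorphisms depend continuously on the
images of the generators (`continuous_endo`), and a continuous bijection from a compact space to a
Hausdorff space is a homeomorphism.

For part (3), `Â` is a free `Ẑ`-module on `a₀, a₁`, so that its automorphisms are invertible
matrices, and the compactness argument applies again. Automorphisms of `Â` lift to `M̂` by
Gaschütz's lemma (`TopGenerates.exists_lift`) and the Hopf property.
-/

noncomputable section

namespace ProMetabelian

/-! ### Topology of the completed group ring -/

section CompletedRing

variable {G : Type*} [Group G] [TopologicalSpace G]

/-- The infimum of two levels. -/
def Level.inf (i j : Level G) : Level G := ⟨i.n * j.n, i.U ⊓ j.U⟩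

theorem CompletedGroupRing.level_eq_of_level_eq {r s : CompletedGroupRing G} {i j : Level G}
    (hn : (j.n : ℕ) ∣ i.n) (hU : i.U.toSubgroup ≤ j.U.toSubgroup) (h : r.1 i = s.1 i) :
    r.1 j = s.1 j := by
  rw [← r.2 i j hn hU, ← s.2 i j hn hU, h]

theorem CompletedGroupRing.level_inf_left {r s : CompletedGroupRing G} {i j : Level G}
    (h : r.1 (i.inf j) = s.1 (i.inf j)) : r.1 i = s.1 i :=
  level_eq_of_level_eq (by simp [Level.inf])
    (inf_le_left (a := i.U.toSubgroup) (b := j.U.toSubgroup)) h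

theorem CompletedGroupRing.level_inf_right {r s : CompletedGroupRing G} {i j : Level G}
    (h : r.1 (i.inf j) = s.1 (i.inf j)) : r.1 j = s.1 j :=
  level_eq_of_level_eq (by simp [Level.inf])
    (inf_le_right (a := i.U.toSubgroup) (b := j.U.toSubgroup)) h

theorem CompletedGroupRing.isOpen_level (i : Level G) (S : Set (LevelRing i)) :
    IsOpen {r : CompletedGroupRing G | r.1 i ∈ S} := by
  -- The finite group rings carry no global topology; here and below they are made discrete.
  let : ∀ j : Level G, TopologicalSpace (LevelRing j) := fun _ => ⊥
  have : ∀ j : Level G, DiscreteTopology (LevelRing j) := fun _ => ⟨rfl⟩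
  have hc : Continuous fun r : CompletedGroupRing G => r.1 i :=
    (continuous_apply i).comp continuous_induced_dom
  exact (isOpen_discrete S).preimage hc

theorem CompletedGroupRing.eventually_level (i : Level G) (r : CompletedGroupRing G) :
    ∀ᶠ s in nhds r, s.1 i = r.1 i :=
  (isOpen_level i {r.1 i}).mem_nhds rfl

/-- A map to `Ẑ[[G]]` is continuous when its components are locally constant. -/
theorem CompletedGroupRing.continuous_of_level {X : Type*} [TopologicalSpace X]
    {f : X → CompletedGroupRing G}
    (h : ∀ (i : Level G) (x : X), ∀ᶠ y in nhds x, (f y).1 i = (f x).1 i) : Continuous f := by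
  let : ∀ j : Level G, TopologicalSpace (LevelRing j) := fun _ => ⊥
  have : ∀ j : Level G, DiscreteTopology (LevelRing j) := fun _ => ⟨rfl⟩
  refine continuous_induced_rng.mpr (continuous_pi fun i => ?_)
  rw [continuous_iff_continuousAt]
  intro x
  exact continuousAt_const.congr ((h i x).mono fun y hy => hy.symm)

instance : IsTopologicalRing (CompletedGroupRing G) where
  continuous_add := CompletedGroupRing.continuous_of_level fun i x => by
    filter_upwards [(continuous_fst.tendsto x).eventually
      (CompletedGroupRing.eventually_level i x.1), (continuous_snd.tendsto x).eventually
      (CompletedGroupRing.eventually_level i x.2)] with y h1 h2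
    exact congrArg₂ (· + ·) h1 h2
  continuous_mul := CompletedGroupRing.continuous_of_level fun i x => by
    filter_upwards [(continuous_fst.tendsto x).eventually
      (CompletedGroupRing.eventually_level i x.1), (continuous_snd.tendsto x).eventually
      (CompletedGroupRing.eventually_level i x.2)] with y h1 h2
    exact congrArg₂ (· * ·) h1 h2
  continuous_neg := CompletedGroupRing.continuous_of_level fun i x => by
    filter_upwards [CompletedGroupRing.eventually_level i x] with y h1
    exact congrArg Neg.neg h1

instance : T2Space (CompletedGroupRing G) := by
  let : ∀ j : Level G, TopologicalSpace (LevelRing j) := fun _ => ⊥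
  have : ∀ j : Level G, DiscreteTopology (LevelRing j) := fun _ => ⟨rfl⟩
  exact T2Space.of_injective_continuous (f := fun r : CompletedGroupRing G => r.1)
    Subtype.val_injective continuous_induced_dom

instance [IsTopologicalGroup G] [CompactSpace G] (i : Level G) : Finite (G ⧸ i.U.toSubgroup) :=
  Subgroup.quotient_finite_of_isOpen _ i.U.isOpen

instance [IsTopologicalGroup G] [CompactSpace G] (i : Level G) : Finite (LevelRing i) :=
  Finite.of_injective _
    (DFunLike.coe_injective.comp (MonoidAlgebra.coeff_injective (R := ZMod i.n)))

instance [IsTopologicalGroup G] [CompactSpace G] : CompactSpace (CompletedGroupRing G) := by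
  let : ∀ j : Level G, TopologicalSpace (LevelRing j) := fun _ => ⊥
  have : ∀ j : Level G, DiscreteTopology (LevelRing j) := fun _ => ⟨rfl⟩
  refine Topology.IsClosedEmbedding.compactSpace
    (f := fun r : CompletedGroupRing G => (r.1 : ∀ i, LevelRing i))
    ⟨⟨⟨rfl⟩, Subtype.val_injective⟩, ?_⟩
  have : Set.range (fun r : CompletedGroupRing G => (r.1 : ∀ i, LevelRing i)) =
      ⋂ (i : Level G) (j : Level G) (hn : (j.n : ℕ) ∣ i.n)
        (hU : i.U.toSubgroup ≤ j.U.toSubgroup), {r | transition i j hn hU (r i) = r j} := by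
    ext r
    simp only [Set.mem_iInter]
    exact ⟨by rintro ⟨s, rfl⟩; exact s.2, fun h => ⟨⟨r, h⟩, rfl⟩⟩
  rw [this]
  refine isClosed_iInter fun i => isClosed_iInter fun j => isClosed_iInter fun hn =>
    isClosed_iInter fun hU => isClosed_eq ?_ (continuous_apply j)
  exact (continuous_of_discreteTopology (f := transition i j hn hU)).comp (continuous_apply i)

theorem CompletedGroupRing.level_surjective (i : Level G) (x : LevelRing i) :
    ∃ r : CompletedGroupRing G, r.1 i = x := by
  obtain ⟨s, rfl⟩ := intRed_surjective i x
  exact ⟨⟨fun j => intRed j s, fun j k hn hU => transition_intRed j k hn hU s⟩, rfl⟩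

theorem CompletedGroupRing.ext_level {r s : CompletedGroupRing G} (h : ∀ i, r.1 i = s.1 i) :
    r = s := Subtype.ext (funext h)

theorem transition_single (i j : Level G) (hn : (j.n : ℕ) ∣ i.n)
    (hU : i.U.toSubgroup ≤ j.U.toSubgroup) (g : G) (c : ZMod i.n) :
    transition i j hn hU (MonoidAlgebra.single (QuotientGroup.mk g) c) =
      MonoidAlgebra.single (QuotientGroup.mk g) (ZMod.castHom hn (ZMod j.n) c) := by
  simp only [transition, RingHom.comp_apply, MonoidAlgebra.mapRingHom_single]
  exact MonoidAlgebra.mapDomain_single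

theorem of_level (g : G) (i : Level G) :
    (of g : CompletedGroupRing G).1 i = MonoidAlgebra.single (QuotientGroup.mk g) 1 := rfl

theorem continuous_of [IsTopologicalGroup G] :
    Continuous (of : G → CompletedGroupRing G) :=
  CompletedGroupRing.continuous_of_level fun i g => by
    have : (fun h => g⁻¹ * h) ⁻¹' (i.U : Set G) ∈ nhds g :=
      (i.U.toOpenSubgroup.isOpen.preimage (by fun_prop)).mem_nhds (by simp [one_mem])
    filter_upwards [this] with h hh
    rw [of_level, of_level, QuotientGroup.eq.mpr hh]

/-- A condition at each level which is stable under passing to coarser levels, and solvable at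
each level, is solvable in the limit. -/
theorem CompletedGroupRing.exists_of_forall_level [IsTopologicalGroup G] [CompactSpace G]
    {X : Type*} [TopologicalSpace X] [CompactSpace X] (f : X → CompletedGroupRing G)
    (hf : Continuous f) (r : CompletedGroupRing G) (h : ∀ i, ∃ x, (f x).1 i = r.1 i) :
    ∃ x, f x = r := by
  let C : Level G → Set X := fun i => {x | (f x).1 i = r.1 i}
  have hcl : ∀ i, IsClosed (C i) := fun i => by
    have : IsClosed {s : CompletedGroupRing G | s.1 i = r.1 i} :=
      ⟨isOpen_level i {y | y ≠ r.1 i}⟩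
    exact this.preimage hf
  have : Nonempty (Level G) := ⟨topLevel G 1⟩
  obtain ⟨x, hx⟩ := IsCompact.nonempty_iInter_of_directed_nonempty_isCompact_isClosed C
    (fun i j => ⟨i.inf j, fun x hx => level_inf_left hx, fun x hx => level_inf_right hx⟩)
    h (fun i => (hcl i).isCompact) hcl
  exact ⟨x, ext_level fun i => Set.mem_iInter.mp hx i⟩

end CompletedRing

section Act

variable {G : Type*} [Group G] [TopologicalSpace G] {V : Type*} [AddCommGroup V]
  [DistribMulAction G V] [TopologicalSpace V] [IsTopologicalGroup G] [CompactSpace G]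
  [IsTopologicalAddGroup V] [CompactSpace V] [ContinuousSMul G V] [TotallyDisconnectedSpace V]

/-- The open `G`-stable subgroups form a neighbourhood basis of `0`. -/
theorem exists_stable_subset (S : Set V) (hS : IsOpen S) (h0 : (0 : V) ∈ S) :
    ∃ W : AddSubgroup V, IsOpen (W : Set V) ∧ Stable G W ∧ (W : Set V) ⊆ S := by
  let I := {W : AddSubgroup V // IsOpen (W : Set V) ∧ Stable G W}
  have : Nonempty I := ⟨⟨⊤, isOpen_univ, fun _ _ _ => trivial⟩⟩
  have hcl : ∀ W : I, IsClosed (W.1 : Set V) := fun W => AddSubgroup.isClosed_of_isOpen W.1 W.2.1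
  obtain ⟨W, hW⟩ := exists_subset_nhds_of_isCompact' (V := fun W : I => (W.1 : Set V)) (U := S)
    (fun W W' => ⟨⟨W.1 ⊓ W'.1, W.2.1.inter W'.2.1,
      fun g w hw => ⟨W.2.2 g w hw.1, W'.2.2 g w hw.2⟩⟩, fun x hx => hx.1, fun x hx => hx.2⟩)
    (fun W => (hcl W).isCompact) hcl (by
      intro x hx
      have : x = 0 := eq_zero_of_forall_stable (G := G) x fun W hW hs =>
        Set.mem_iInter.mp hx ⟨W, hW, hs⟩
      exact hS.mem_nhds (this ▸ h0))
  exact ⟨W.1, W.2.1, W.2.2, hW⟩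

theorem continuous_act (v : V) : Continuous fun r : CompletedGroupRing G => act r v := by
  rw [continuous_iff_continuousAt]
  intro r
  refine continuousAt_def.mpr fun A hA => ?_
  obtain ⟨S, hSA, hS, hrS⟩ := mem_nhds_iff.mp hA
  obtain ⟨W, hW, hst, hWS⟩ := exists_stable_subset (G := G) ((fun w => w + act r v) ⁻¹' S)
    (hS.preimage (by fun_prop)) (by simpa using hrS)
  obtain ⟨i, hi⟩ := exists_adapted (G := G) W hW hst
  obtain ⟨s, hs⟩ := intRed_surjective i (r.1 i)
  filter_upwards [CompletedGroupRing.eventually_level i r] with r' hr'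
  have h := W.sub_mem (isAct_act r' v W hW hst i hi s (hs.trans hr'.symm))
    (isAct_act r v W hW hst i hi s hs)
  rw [sub_sub_sub_cancel_right] at h
  have := hWS h
  rw [Set.mem_preimage, sub_add_cancel] at this
  exact hSA this

end Act

/-! ### Ideals generated by augmentation elements -/

section Koszul

variable {H : Type*} [CommGroup H] [TopologicalSpace H]

/-- If `U ≤ V` and `V` is generated by `U` and `a, b`, then the kernel of
`(ℤ/n)[H/U] → (ℤ/n)[H/V]` is generated by `1 - a` and `1 - b`. -/
theorem exists_of_transition_eq_zero (i j : Level H) (hn : (j.n : ℕ) ∣ i.n)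
    (hn' : j.n = i.n) (hU : i.U.toSubgroup ≤ j.U.toSubgroup) (a b : H)
    (hab : j.U.toSubgroup ≤ i.U.toSubgroup ⊔ Subgroup.closure {a, b}) (x : LevelRing i)
    (hx : transition i j hn hU x = 0) :
    ∃ t t' : LevelRing i, t * (1 - MonoidAlgebra.single (QuotientGroup.mk a) 1) +
      t' * (1 - MonoidAlgebra.single (QuotientGroup.mk b) 1) = x := by
  obtain ⟨n, U⟩ := i
  obtain ⟨m, V⟩ := j
  obtain rfl : m = n := hn'
  let A : LevelRing ⟨m, U⟩ := 1 - MonoidAlgebra.single (QuotientGroup.mk a) 1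
  let B : LevelRing ⟨m, U⟩ := 1 - MonoidAlgebra.single (QuotientGroup.mk b) 1
  let I : Ideal (LevelRing ⟨m, U⟩) := Ideal.span {A, B}
  let φ : H →* LevelRing ⟨m, U⟩ ⧸ I :=
    (Ideal.Quotient.mk I).toMonoidHom.comp
      ((MonoidAlgebra.of (ZMod m) (H ⧸ U.toSubgroup)).comp (QuotientGroup.mk' U.toSubgroup))
  have hφ : ∀ g, φ g = Ideal.Quotient.mk I (MonoidAlgebra.single (QuotientGroup.mk g) 1) :=
    fun g => rfl
  have hker : V.toSubgroup ≤ φ.ker := by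
    refine hab.trans (sup_le (fun g hg => ?_) ?_)
    · rw [MonoidHom.mem_ker, hφ, (QuotientGroup.eq_one_iff g).mpr hg]
      exact map_one _
    · rw [Subgroup.closure_le]
      rintro g (rfl | rfl)
      · rw [SetLike.mem_coe, MonoidHom.mem_ker, hφ, ← map_one (Ideal.Quotient.mk I), eq_comm,
          Ideal.Quotient.eq]
        exact Ideal.subset_span (Set.mem_insert _ _)
      · rw [SetLike.mem_coe, MonoidHom.mem_ker, hφ, ← map_one (Ideal.Quotient.mk I), eq_comm,
          Ideal.Quotient.eq]
        exact Ideal.subset_span (Set.mem_insert_of_mem _ rfl)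
  let ψ : LevelRing ⟨m, V⟩ →ₐ[ZMod m] LevelRing ⟨m, U⟩ ⧸ I :=
    MonoidAlgebra.lift (ZMod m) _ (H ⧸ V.toSubgroup) (QuotientGroup.lift V.toSubgroup φ hker)
  have key : ψ.toRingHom.comp (transition ⟨m, U⟩ ⟨m, V⟩ hn hU) = Ideal.Quotient.mk I := by
    apply MonoidAlgebra.ringHom_ext
    · intro c
      obtain ⟨z, rfl⟩ := ZMod.intCast_surjective c
      rw [← MonoidAlgebra.intCast_def, map_intCast, map_intCast]
    · intro q
      obtain ⟨g, rfl⟩ := QuotientGroup.mk_surjective q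
      rw [RingHom.comp_apply, transition_single, map_one]
      change ψ (MonoidAlgebra.single _ 1) = _
      rw [MonoidAlgebra.lift_single, one_smul]
      rfl
  have h0 : Ideal.Quotient.mk I x = 0 := by
    rw [← key, RingHom.comp_apply, hx, map_zero]
  obtain ⟨t, t', h⟩ := Ideal.mem_span_pair.mp (Ideal.Quotient.eq_zero_iff_mem.mp h0)
  exact ⟨t, t', h⟩

/-- An element which vanishes at all levels `(n, U)` with `a, b ∈ U` lies in the ideal generated by
`1 - a` and `1 - b`. -/
theorem exists_eq_of_forall_level_eq_zero [IsTopologicalGroup H] [CompactSpace H] (a b : H)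
    (s : CompletedGroupRing H) (hs : ∀ i : Level H, a ∈ i.U → b ∈ i.U → s.1 i = 0) :
    ∃ t t' : CompletedGroupRing H, s = t * (1 - of a) + t' * (1 - of b) := by
  obtain ⟨⟨t, t'⟩, h⟩ := CompletedGroupRing.exists_of_forall_level
    (fun p : CompletedGroupRing H × CompletedGroupRing H => p.1 * (1 - of a) + p.2 * (1 - of b))
    (((continuous_fst.mul continuous_const).add (continuous_snd.mul continuous_const))) s (by
      intro i
      let V : OpenNormalSubgroup H :=
        { toSubgroup := i.U.toSubgroup ⊔ Subgroup.closure {a, b}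
          isOpen' := Subgroup.isOpen_mono le_sup_left i.U.isOpen
          isNormal' := inferInstance }
      have hab : Subgroup.closure {a, b} ≤ V.toSubgroup := le_sup_right
      obtain ⟨t, t', h⟩ := exists_of_transition_eq_zero i ⟨i.n, V⟩ dvd_rfl rfl
        le_sup_left a b le_rfl (s.1 i) (by
          rw [s.2 i ⟨i.n, V⟩ dvd_rfl le_sup_left]
          exact hs ⟨i.n, V⟩ (hab (Subgroup.subset_closure (by simp)))
            (hab (Subgroup.subset_closure (by simp))))
      obtain ⟨t, rfl⟩ := CompletedGroupRing.level_surjective i t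
      obtain ⟨t', rfl⟩ := CompletedGroupRing.level_surjective i t'
      exact ⟨(t, t'), h⟩)
  exact ⟨t, t', h.symm⟩

theorem level_nsmul_eq_zero {G : Type*} [Group G] [TopologicalSpace G] (i : Level G)
    (x : LevelRing i) : (i.n : ℕ) • x = 0 := by
  rw [nsmul_eq_mul, MonoidAlgebra.natCast_def, ZMod.natCast_self, MonoidAlgebra.single_zero,
    zero_mul]

/-- A sum over a group of a function constant on the left cosets of `S` is a multiple of `|S|`. -/
theorem sum_eq_zero_of_coset_invariant {Q A : Type*} [Group Q] [Fintype Q]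
    [AddCommMonoid A] (S : Subgroup Q) (F : Q → A) (hF : ∀ q, ∀ s ∈ S, F (q * s) = F q)
    (hA : ∀ x : A, Nat.card S • x = 0) : ∑ q, F q = 0 := by
  have := Fintype.ofFinite S
  have := Fintype.ofFinite (Q ⧸ S)
  -- `Q` is the product of a transversal and `S`.
  have hb : Function.Bijective fun p : (Q ⧸ S) × S => p.1.out * (p.2 : Q) := by
    constructor
    · rintro ⟨c, s⟩ ⟨d, t⟩ h
      have hcd : c = d := by
        have := congrArg (QuotientGroup.mk (s := S)) h
        simpa using this
      subst hcd
      exact Prod.ext rfl (Subtype.ext (mul_left_cancel h))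
    · intro q
      refine ⟨((q : Q ⧸ S), ⟨(q : Q ⧸ S).out⁻¹ * q, QuotientGroup.eq.mp (by simp)⟩), ?_⟩
      simp
  rw [← hb.sum_comp, Fintype.sum_prod_type]
  refine Finset.sum_eq_zero fun c _ => ?_
  rw [Finset.sum_congr rfl fun s _ => hF c.out (s : S) s.2, Finset.sum_const, Finset.card_univ,
    ← Nat.card_eq_fintype_card, hA]

/-- If `r` is invariant under `a` at the level `(n, V)`, and `a ^ k` lies in `U ≥ V` and has order
divisible by `n` modulo `V`, then `r` vanishes at the level `(n, U)`: its coefficients there are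
sums over the orbits of `a ^ k`, hence multiples of `n`. -/
theorem level_eq_zero_of_invariant [IsTopologicalGroup H] [CompactSpace H] (i : Level H)
    (V : OpenNormalSubgroup H) (hV : V.toSubgroup ≤ i.U.toSubgroup) (a : H) (k : ℕ)
    (hk : a ^ k ∈ i.U) (ho : (i.n : ℕ) ∣ orderOf (QuotientGroup.mk (a ^ k) : H ⧸ V.toSubgroup))
    (r : CompletedGroupRing H) (hr : (r * (1 - of a)).1 ⟨i.n, V⟩ = 0) : r.1 i = 0 := by
  let j : Level H := ⟨i.n, V⟩
  have h1 : r.1 j * MonoidAlgebra.single (QuotientGroup.mk a) 1 = r.1 j := by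
    have : r.1 j * (1 - MonoidAlgebra.single (QuotientGroup.mk a) 1) = 0 := hr
    rw [mul_sub, mul_one, sub_eq_zero] at this
    exact this.symm
  have h2 : ∀ m : ℕ, r.1 j * MonoidAlgebra.single (QuotientGroup.mk (a ^ m)) 1 = r.1 j := by
    intro m
    induction m with
    | zero => rw [pow_zero]; exact mul_one _
    | succ m ih =>
      have : (MonoidAlgebra.single (QuotientGroup.mk (a ^ (m + 1))) 1 : LevelRing j) =
          MonoidAlgebra.single (QuotientGroup.mk (a ^ m)) 1 *
            MonoidAlgebra.single (QuotientGroup.mk a) 1 := by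
        rw [MonoidAlgebra.single_mul_single, pow_succ, QuotientGroup.mk_mul, one_mul]
      rw [this, ← mul_assoc, ih, h1]
  have := Fintype.ofFinite (H ⧸ j.U.toSubgroup)
  let b : H ⧸ j.U.toSubgroup := QuotientGroup.mk (a ^ k)
  let π : H ⧸ j.U.toSubgroup →* H ⧸ i.U.toSubgroup :=
    QuotientGroup.map j.U.toSubgroup i.U.toSubgroup (MonoidHom.id H) hV
  have hπb : π b = 1 := (QuotientGroup.eq_one_iff _).mpr hk
  let F : H ⧸ j.U.toSubgroup → LevelRing i := fun q =>
    MonoidAlgebra.single (π q) ((r.1 j).coeff q)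
  have hsum : r.1 i = ∑ q, F q := by
    rw [← r.2 j i dvd_rfl hV]
    have h : r.1 j = ∑ q, MonoidAlgebra.single q ((r.1 j).coeff q) := by
      conv_lhs => rw [← MonoidAlgebra.sum_coeff_single (r.1 j)]
      exact Finsupp.sum_fintype _ _ fun q => MonoidAlgebra.single_zero q
    rw [h, map_sum]
    refine Finset.sum_congr rfl fun q _ => ?_
    obtain ⟨g, rfl⟩ := QuotientGroup.mk_surjective q
    rw [transition_single, ZMod.castHom_self]
    rfl
  rw [hsum]
  refine sum_eq_zero_of_coset_invariant (Subgroup.zpowers b) F ?_ ?_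
  · intro q s hs
    obtain ⟨m, rfl⟩ := mem_powers_iff_mem_zpowers.mpr hs
    have h3 := h2 (k * m)
    rw [pow_mul, QuotientGroup.mk_pow] at h3
    have h4 : (r.1 j).coeff (q * b ^ m) = (r.1 j).coeff q := by
      conv_lhs => rw [← h3]
      rw [MonoidAlgebra.coeff_mul_single_apply]
      simp [b]
    change MonoidAlgebra.single (π (q * b ^ m)) ((r.1 j).coeff (q * b ^ m)) = F q
    rw [h4, map_mul, map_pow, hπb, one_pow, mul_one]
  · intro x
    rw [Nat.card_zpowers]
    obtain ⟨d, hd⟩ := ho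
    rw [hd, mul_comm, mul_nsmul, level_nsmul_eq_zero]

end Koszul

/-! ### Topological generation of profinite groups -/

section Generation

/-- A bijective continuous endomorphism of a compact Hausdorff group is an automorphism. -/
def ContAut.ofBijective {G : Type*} [Group G] [TopologicalSpace G]
    [CompactSpace G] [T2Space G] (f : G →ₜ* G) (hf : Function.Bijective f) :
    ContAut G :=
  ({ MulEquiv.ofBijective f.toMonoidHom hf with
      continuous_toFun := f.continuous_toFun
      continuous_invFun := (isHomeomorph_iff_continuous_bijective.mpr
        ⟨f.continuous_toFun, hf⟩).homeomorph.symm.continuous.congr fun z =>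
          (Homeomorph.symm_apply_eq _).mpr
            ((MulEquiv.ofBijective f.toMonoidHom hf).apply_symm_apply z).symm } : G ≃ₜ* G)

variable {G : Type*} [Group G] [TopologicalSpace G] [IsTopologicalGroup G] {ι : Type*}

theorem TopGenerates.mem_of_isClosed {x : ι → G} (hx : TopGenerates x) {K : Subgroup G}
    (hK : IsClosed (K : Set G)) (h : ∀ i, x i ∈ K) (g : G) : g ∈ K := by
  have h1 : (Subgroup.closure (Set.range x)).topologicalClosure ≤ K :=
    Subgroup.topologicalClosure_minimal _
      ((Subgroup.closure_le K).mpr (by rintro _ ⟨i, rfl⟩; exact h i)) hK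
  have h2 : (Subgroup.closure (Set.range x)).topologicalClosure = ⊤ := hx
  exact h1 (h2 ▸ Subgroup.mem_top g)

theorem TopGenerates.hom_ext {P : Type*} [Group P] [TopologicalSpace P] [T2Space P]
    {x : ι → G} (hx : TopGenerates x) {f g : G →ₜ* P} (h : ∀ i, f (x i) = g (x i)) : f = g := by
  ext y
  exact hx.mem_of_isClosed (K := f.toMonoidHom.eqLocus g.toMonoidHom)
    (isClosed_eq f.continuous_toFun g.continuous_toFun) h y

theorem TopGenerates.surjective {P : Type*} [Group P] [TopologicalSpace P] [T2Space P]
    [CompactSpace P] {y : ι → G} [T2Space G] (hy : TopGenerates y) (f : P →ₜ* G)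
    (h : ∀ i, y i ∈ Set.range f) : Function.Surjective f := by
  intro g
  exact hy.mem_of_isClosed (K := f.toMonoidHom.range)
    (isCompact_range f.continuous_toFun).isClosed h g

theorem TopGenerates.map {P : Type*} [Group P] [TopologicalSpace P] [IsTopologicalGroup P]
    {x : ι → G} (hx : TopGenerates x) (f : G →* P) (hf : Continuous f)
    (hs : Function.Surjective f) : TopGenerates fun i => f (x i) := by
  refine (Subgroup.eq_top_iff' _).mpr fun p => ?_
  obtain ⟨g, rfl⟩ := hs p
  exact hx.mem_of_isClosed
    (K := (Subgroup.closure (Set.range fun i => f (x i))).topologicalClosure.comap f)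
    ((Subgroup.isClosed_topologicalClosure _).preimage hf)
    (fun i => Subgroup.le_topologicalClosure _ (Subgroup.subset_closure ⟨i, rfl⟩)) g

/-- Finitely generated profinite groups are Hopfian: a surjective endomorphism permutes the
finite set of homomorphisms to any given finite group by composition. -/
theorem TopGenerates.injective_of_surjective [CompactSpace G] [TotallyDisconnectedSpace G]
    [Finite ι] {x : ι → G} (hx : TopGenerates x) (f : G →ₜ* G) (hf : Function.Surjective f) :
    Function.Injective f := by
  refine (injective_iff_map_eq_one f).mpr fun g hg => ?_
  by_contra hg1
  have hT : T1Space G := inferInstance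
  obtain ⟨U, hU⟩ := ProfiniteGrp.exist_openNormalSubgroup_sub_open_nhds_of_one
    (U := ({g}ᶜ : Set G)) isOpen_compl_singleton (fun h => hg1 h.symm)
  have : Finite (G ⧸ U.toSubgroup) := Subgroup.quotient_finite_of_isOpen _ U.isOpen
  let X := {h : G →* G ⧸ U.toSubgroup // IsOpen (h.ker : Set G)}
  have hX : Finite X := by
    refine Finite.of_injective (fun h : X => fun i => h.1 (x i)) fun h h' hh => ?_
    refine Subtype.ext (MonoidHom.ext fun y => ?_)
    have hop : IsOpen (h.1.eqLocus h'.1 : Set G) := by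
      refine Subgroup.isOpen_mono (H₁ := h.1.ker ⊓ h'.1.ker) ?_ (h.2.inter h'.2)
      intro z hz
      exact (MonoidHom.mem_ker.mp hz.1).trans (MonoidHom.mem_ker.mp hz.2).symm
    exact hx.mem_of_isClosed (Subgroup.isClosed_of_isOpen _ hop) (fun i => congrFun hh i) y
  let c : X → X := fun h => ⟨h.1.comp f.toMonoidHom, h.2.preimage f.continuous_toFun⟩
  have hc : Function.Injective c := by
    intro h h' hh
    refine Subtype.ext (MonoidHom.ext fun y => ?_)
    obtain ⟨z, rfl⟩ := hf y
    exact DFunLike.congr_fun (congrArg Subtype.val hh) z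
  obtain ⟨h, hh⟩ := Finite.surjective_of_injective hc
    ⟨QuotientGroup.mk' U.toSubgroup, by rw [QuotientGroup.ker_mk']; exact U.isOpen⟩
  have h1 : h.1 (f g) = QuotientGroup.mk g := DFunLike.congr_fun (congrArg Subtype.val hh) g
  rw [hg, map_one] at h1
  exact hU ((QuotientGroup.eq_one_iff g).mp h1.symm) rfl

end Generation

/-! ### Lifting generators -/

section Gaschutz

/-- The number of lifts of a tuple `t`, generating `G` modulo `N`, to a tuple generating a given
subgroup `K` does not depend on `t`. -/
theorem card_generating_lifts_eq {G ι : Type*} [Group G] [Fintype G] [Fintype ι]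
    (N : Subgroup G) [N.Normal] (K : Subgroup G) :
    ∀ s t : ι → G, Subgroup.closure (Set.range s) ⊔ N = ⊤ →
      Subgroup.closure (Set.range t) ⊔ N = ⊤ →
      Nat.card {s' : ι → G // (∀ i, (s i)⁻¹ * s' i ∈ N) ∧ Subgroup.closure (Set.range s') = K} =
      Nat.card {t' : ι → G // (∀ i, (t i)⁻¹ * t' i ∈ N) ∧
        Subgroup.closure (Set.range t') = K} := by
  classical
  induction K using WellFoundedLT.induction with
  | ind K ih =>
  intro s t hs ht
  by_cases hKN : K ⊔ N = ⊤
  · -- The lifts with values in `K` are sorted by the subgroup they generate; by induction only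
    -- those generating `K` itself remain to be compared.
    have hcount : ∀ t : ι → G, Subgroup.closure (Set.range t) ⊔ N = ⊤ →
        Nat.card {t' : ι → G // ∀ i, (t i)⁻¹ * t' i ∈ N ∧ t' i ∈ K} =
        (∑ L ∈ Finset.univ.filter (· < K), Nat.card {t' : ι → G // (∀ i, (t i)⁻¹ * t' i ∈ N) ∧
          Subgroup.closure (Set.range t') = L}) + Nat.card {t' : ι → G //
          (∀ i, (t i)⁻¹ * t' i ∈ N) ∧ Subgroup.closure (Set.range t') = K} := by
      intro t ht
      have h1 : (Finset.univ.filter (· ≤ K) : Finset (Subgroup G)) =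
          insert K (Finset.univ.filter (· < K)) := by
        ext L
        simp [le_iff_eq_or_lt]
      rw [add_comm, ← Finset.sum_insert (a := K)
        (f := fun L => Nat.card {t' : ι → G // (∀ i, (t i)⁻¹ * t' i ∈ N) ∧
          Subgroup.closure (Set.range t') = L}) (by simp), ← h1]
      simp only [Nat.card_eq_fintype_card, Fintype.card_subtype]
      rw [Finset.card_eq_sum_card_fiberwise (f := fun t' => Subgroup.closure (Set.range t'))
        (t := Finset.univ.filter (· ≤ K))]
      · refine Finset.sum_congr rfl fun L hL => ?_
        congr 1
        ext t'
        simp only [Finset.mem_filter, Finset.mem_univ, true_and] at hL ⊢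
        constructor
        · rintro ⟨h, h'⟩
          exact ⟨fun i => (h i).1, h'⟩
        · rintro ⟨h, h'⟩
          exact ⟨fun i => ⟨h i, hL (h' ▸ Subgroup.subset_closure ⟨i, rfl⟩)⟩, h'⟩
      · intro t' ht'
        simp only [Finset.coe_filter, Finset.mem_univ, true_and, Set.mem_ofPred_eq] at ht' ⊢
        rw [Subgroup.closure_le]
        rintro _ ⟨i, rfl⟩
        exact (ht' i).2
    have hK : ∀ g : G, ∃ k ∈ K, g⁻¹ * k ∈ N := by
      intro g
      have : g ∈ K ⊔ N := hKN ▸ Subgroup.mem_top g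
      obtain ⟨k, hk, n, hn, rfl⟩ := Subgroup.mem_sup_of_normal_right.mp this
      exact ⟨k, hk, by simpa using hn⟩
    choose k hk hkN using hK
    -- Since `K N = G`, the cosets of `N` have representatives `k (s i)`, `k (t i)` in `K`, and
    -- translation by them identifies the lifts of `t` in `K` with the lifts of `s` in `K`.
    have hmove : ∀ s t t' : ι → G, (∀ i, (t i)⁻¹ * t' i ∈ N ∧ t' i ∈ K) →
        ∀ i, (s i)⁻¹ * (k (s i) * (k (t i))⁻¹ * t' i) ∈ N ∧ k (s i) * (k (t i))⁻¹ * t' i ∈ K := by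
      intro s t t' h i
      refine ⟨?_, K.mul_mem (K.mul_mem (hk _) (K.inv_mem (hk _))) (h i).2⟩
      have := N.mul_mem (hkN (s i)) (N.mul_mem (N.inv_mem (hkN (t i))) (h i).1)
      convert this using 1
      group
    have hS : Nat.card {s' : ι → G // ∀ i, (s i)⁻¹ * s' i ∈ N ∧ s' i ∈ K} =
        Nat.card {t' : ι → G // ∀ i, (t i)⁻¹ * t' i ∈ N ∧ t' i ∈ K} :=
      Nat.card_congr
        { toFun := fun s' => ⟨_, hmove t s s'.1 s'.2⟩
          invFun := fun t' => ⟨_, hmove s t t'.1 t'.2⟩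
          left_inv := fun s' => Subtype.ext (funext fun i => by simp [mul_assoc])
          right_inv := fun t' => Subtype.ext (funext fun i => by simp [mul_assoc]) }
    rw [hcount s hs, hcount t ht, Finset.sum_congr rfl fun L hL =>
      ih L (Finset.mem_filter.mp hL).2 s t hs ht] at hS
    exact Nat.add_left_cancel hS
  · have hempty : ∀ t : ι → G, Subgroup.closure (Set.range t) ⊔ N = ⊤ →
        IsEmpty {t' : ι → G // (∀ i, (t i)⁻¹ * t' i ∈ N) ∧
          Subgroup.closure (Set.range t') = K} := by
      refine fun t ht => ⟨fun ⟨t', h, h'⟩ => hKN ?_⟩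
      rw [eq_top_iff, ← ht, ← h']
      refine sup_le ?_ le_sup_right
      rw [Subgroup.closure_le]
      rintro _ ⟨i, rfl⟩
      have h1 : t' i ∈ Subgroup.closure (Set.range t') ⊔ N :=
        (le_sup_left : _ ≤ Subgroup.closure (Set.range t') ⊔ N)
          (Subgroup.subset_closure ⟨i, rfl⟩)
      have h2 : ((t i)⁻¹ * t' i)⁻¹ ∈ Subgroup.closure (Set.range t') ⊔ N :=
        (le_sup_right : N ≤ _) (N.inv_mem (h i))
      have := mul_mem h1 h2
      simpa using this
    have := hempty s hs
    have := hempty t ht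
    rw [Nat.card_of_isEmpty, Nat.card_of_isEmpty]

/-- **Gaschütz's lemma**: a tuple generating `G` modulo `N` lifts to a generating tuple, provided
that `G` has a generating tuple of the same length. -/
theorem exists_generating_lift {G ι : Type*} [Group G] [Finite G] [Finite ι]
    (N : Subgroup G) [N.Normal] {g h : ι → G} (hg : Subgroup.closure (Set.range g) = ⊤)
    (hh : Subgroup.closure (Set.range h) ⊔ N = ⊤) :
    ∃ h' : ι → G, (∀ i, (h i)⁻¹ * h' i ∈ N) ∧ Subgroup.closure (Set.range h') = ⊤ := by
  have := Fintype.ofFinite G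
  have := Fintype.ofFinite ι
  have h1 := card_generating_lifts_eq N ⊤ g h (by rw [hg, top_sup_eq]) hh
  have : Nonempty {s' : ι → G // (∀ i, (g i)⁻¹ * s' i ∈ N) ∧
      Subgroup.closure (Set.range s') = ⊤} := ⟨⟨g, fun i => by simp [one_mem], hg⟩⟩
  have h2 := Nat.card_pos (α := {s' : ι → G // (∀ i, (g i)⁻¹ * s' i ∈ N) ∧
      Subgroup.closure (Set.range s') = ⊤})
  rw [h1] at h2
  obtain ⟨⟨h', h3, h4⟩⟩ := (Nat.card_pos_iff.mp h2).1
  exact ⟨h', h3, h4⟩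

variable {G : Type*} [Group G] [TopologicalSpace G] [IsTopologicalGroup G] {ι : Type*}

theorem topGenerates_of_forall_open [CompactSpace G] [TotallyDisconnectedSpace G] {y : ι → G}
    (h : ∀ U : OpenNormalSubgroup G, Subgroup.closure (Set.range y) ⊔ U.toSubgroup = ⊤) :
    TopGenerates y := by
  let K : ClosedSubgroup G := ⟨(Subgroup.closure (Set.range y)).topologicalClosure,
    Subgroup.isClosed_topologicalClosure _⟩
  have h1 : K.toSubgroup = _ := ProfiniteGrp.closedSubgroup_eq_sInf_open K
  refine h1.trans (eq_top_iff.mpr (le_sInf ?_))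
  rintro L ⟨hL, hKL⟩
  obtain ⟨U, hU⟩ := ProfiniteGrp.exist_openNormalSubgroup_sub_open_nhds_of_one hL L.one_mem
  rw [← h U]
  exact sup_le ((Subgroup.le_topologicalClosure _).trans hKL) hU

theorem TopGenerates.closure_sup_eq_top {x : ι → G} (hx : TopGenerates x) {U : Subgroup G}
    (hU : IsOpen (U : Set G)) : Subgroup.closure (Set.range x) ⊔ U = ⊤ :=
  (Subgroup.eq_top_iff' _).mpr <| hx.mem_of_isClosed
    (Subgroup.isClosed_of_isOpen _ (Subgroup.isOpen_mono le_sup_right hU))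
    fun i => (le_sup_left : _ ≤ Subgroup.closure (Set.range x) ⊔ U)
      (Subgroup.subset_closure ⟨i, rfl⟩)

/-- Gaschütz's lemma for profinite groups. -/
theorem TopGenerates.exists_lift [CompactSpace G] [TotallyDisconnectedSpace G] [Finite ι]
    {x : ι → G} (hx : TopGenerates x) (N : Subgroup G) [N.Normal] (hN : IsClosed (N : Set G))
    (b : ι → G) (hb : TopGenerates fun i => (b i : G ⧸ N)) :
    ∃ y : ι → G, TopGenerates y ∧ ∀ i, (y i : G ⧸ N) = b i := by
  let C : OpenNormalSubgroup G → Set (ι → G) := fun U =>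
    {y | (∀ i, (b i)⁻¹ * y i ∈ N) ∧ Subgroup.closure (Set.range y) ⊔ U.toSubgroup = ⊤}
  have hle : ∀ (U : OpenNormalSubgroup G) (y z : ι → G), (∀ i, (z i)⁻¹ * y i ∈ U) →
      Subgroup.closure (Set.range y) ⊔ U.toSubgroup ≤
        Subgroup.closure (Set.range z) ⊔ U.toSubgroup := by
    intro U y z h
    refine sup_le ((Subgroup.closure_le _).mpr ?_) le_sup_right
    rintro _ ⟨i, rfl⟩
    have h1 : z i ∈ Subgroup.closure (Set.range z) ⊔ U.toSubgroup :=
      (le_sup_left : _ ≤ Subgroup.closure (Set.range z) ⊔ U.toSubgroup)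
        (Subgroup.subset_closure ⟨i, rfl⟩)
    have h2 : (z i)⁻¹ * y i ∈ Subgroup.closure (Set.range z) ⊔ U.toSubgroup :=
      (le_sup_right : U.toSubgroup ≤ _) (h i)
    have := mul_mem h1 h2
    rwa [mul_inv_cancel_left] at this
  have hcl : ∀ U, IsClosed (C U) := by
    intro U
    refine IsClosed.inter (s₁ := {y : ι → G | ∀ i, (b i)⁻¹ * y i ∈ N}) ?_ ?_
    · simp only [Set.ofPred_forall]
      exact isClosed_iInter fun i => hN.preimage (by fun_prop)
    · refine ⟨isOpen_iff_mem_nhds.mpr fun y hy => ?_⟩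
      have : {z : ι → G | ∀ i, (y i)⁻¹ * z i ∈ U} ∈ nhds y := by
        refine IsOpen.mem_nhds ?_ fun i => by simp [one_mem]
        simp only [Set.ofPred_forall]
        exact isOpen_iInter_of_finite fun i =>
          U.toOpenSubgroup.isOpen.preimage (f := fun z : ι → G => (y i)⁻¹ * z i) (by fun_prop)
      filter_upwards [this] with z hz hz'
      exact hy (eq_top_iff.mpr (hz' ▸ hle U z y hz))
  have hne : ∀ U, (C U).Nonempty := by
    intro U
    have : Finite (G ⧸ U.toSubgroup) := Subgroup.quotient_finite_of_isOpen _ U.isOpen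
    let π := QuotientGroup.mk' U.toSubgroup
    have hπ : Function.Surjective π := QuotientGroup.mk'_surjective _
    have hker : π.ker = U.toSubgroup := QuotientGroup.ker_mk' _
    have := Subgroup.Normal.map (H := N) inferInstance π hπ
    have hmap : ∀ y : ι → G, Subgroup.closure (Set.range fun i => π (y i)) =
        (Subgroup.closure (Set.range y)).map π := by
      intro y
      rw [MonoidHom.map_closure, ← Set.range_comp]
      rfl
    have hgen : ∀ K : Subgroup G, K ⊔ U.toSubgroup = ⊤ → K.map π = ⊤ := by
      intro K hK
      rw [← Subgroup.map_top_of_surjective π hπ, ← hK, Subgroup.map_sup,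
        (Subgroup.map_eq_bot_iff _).mpr hker.ge, sup_bot_eq]
    have hbU : Subgroup.closure (Set.range b) ⊔ N ⊔ U.toSubgroup = ⊤ := by
      refine (Subgroup.eq_top_iff' _).mpr fun g => ?_
      have h := (hb.closure_sup_eq_top (U := U.toSubgroup.map (QuotientGroup.mk' N))
        (QuotientGroup.isOpenMap_coe _ U.isOpen))
      have h' : (QuotientGroup.mk' N g) ∈
          (Subgroup.closure (Set.range b) ⊔ U.toSubgroup).map (QuotientGroup.mk' N) := by
        rw [Subgroup.map_sup, MonoidHom.map_closure, ← Set.range_comp]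
        exact h ▸ Subgroup.mem_top _
      obtain ⟨k, hk, hkg⟩ := h'
      have h2 : k⁻¹ * g ∈ N := QuotientGroup.eq.mp hkg
      rw [sup_right_comm]
      have h3 := mul_mem ((le_sup_left : _ ≤ Subgroup.closure (Set.range b) ⊔ U.toSubgroup ⊔ N) hk)
        ((le_sup_right : N ≤ Subgroup.closure (Set.range b) ⊔ U.toSubgroup ⊔ N) h2)
      rwa [mul_inv_cancel_left] at h3
    obtain ⟨h', h1, h2⟩ := exists_generating_lift (N.map π) (g := fun i => π (x i))
      (h := fun i => π (b i)) (by rw [hmap, hgen _ (hx.closure_sup_eq_top U.isOpen)])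
      (by rw [hmap, ← Subgroup.map_sup, hgen _ hbU])
    choose n hn hn' using h1
    have hy : ∀ i, π (b i * n i) = h' i := fun i => by rw [map_mul, hn', mul_inv_cancel_left]
    refine ⟨fun i => b i * n i, fun i => by simpa using hn i, ?_⟩
    have h3 : (Subgroup.closure (Set.range fun i => b i * n i)).map π = ⊤ := by
      rw [← hmap, funext hy, h2]
    rw [← hker, ← Subgroup.comap_map_eq, h3, Subgroup.comap_top]
  have : Nonempty (OpenNormalSubgroup G) := ⟨(topLevel G 1).U⟩
  have hmono : ∀ U V : OpenNormalSubgroup G, U.toSubgroup ≤ V.toSubgroup → C U ⊆ C V :=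
    fun U V h y hy => ⟨hy.1, eq_top_iff.mpr (hy.2 ▸ sup_le_sup_left h _)⟩
  obtain ⟨y, hy⟩ := IsCompact.nonempty_iInter_of_directed_nonempty_isCompact_isClosed C
    (fun U V => ⟨U ⊓ V, hmono _ _ (inf_le_left (a := U.toSubgroup) (b := V.toSubgroup)),
      hmono _ _ (inf_le_right (a := U.toSubgroup) (b := V.toSubgroup))⟩)
    hne (fun U => (hcl U).isCompact) hcl
  refine ⟨y, topGenerates_of_forall_open fun U => (Set.mem_iInter.mp hy U).2, fun i => ?_⟩
  exact (QuotientGroup.eq.mpr ((Set.mem_iInter.mp hy (topLevel G 1).U).1 i)).symm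

end Gaschutz

/-! ### Equivariant maps and the completed group ring -/

section MapAct

theorem map_intAct {G V V' : Type*} [Group G] [TopologicalSpace G] [AddCommGroup V]
    [DistribMulAction G V] [AddCommGroup V'] [DistribMulAction G V'] (f : V →+ V')
    (hf : ∀ (g : G) (v : V), f (g • v) = g • f v) (s : MonoidAlgebra ℤ G) (v : V) :
    f (intAct s v) = intAct s (f v) := by
  induction s using MonoidAlgebra.induction_linear with
  | zero => simp
  | add a b ha hb =>
    rw [map_add, map_add, LinearMap.add_apply, LinearMap.add_apply, map_add, ha, hb]
  | single g c => rw [intAct_single, intAct_single, map_zsmul, hf]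

variable {G : Type*} [Group G] [TopologicalSpace G] {V : Type*} [AddCommGroup V]
  [DistribMulAction G V] [TopologicalSpace V] [IsTopologicalGroup G] [CompactSpace G]
  [IsTopologicalAddGroup V] [CompactSpace V] [ContinuousSMul G V] [TotallyDisconnectedSpace V]

/-- A continuous `G`-equivariant homomorphism is `Ẑ[[G]]`-linear. -/
theorem map_act {V' : Type*} [AddCommGroup V'] [DistribMulAction G V'] [TopologicalSpace V']
    [IsTopologicalAddGroup V'] [CompactSpace V'] [ContinuousSMul G V']
    [TotallyDisconnectedSpace V'] (f : V →+ V') (hc : Continuous f)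
    (hf : ∀ (g : G) (v : V), f (g • v) = g • f v) (r : CompletedGroupRing G) (v : V) :
    f (act r v) = act r (f v) := by
  refine (act_eq_iff.mpr ?_).symm
  intro W hW hst i hi s hs
  have := isAct_act r v (W.comap f) (hW.preimage hc)
    (fun g v hv => by
      rw [AddSubgroup.mem_comap, hf]; exact hst g _ hv) i
    ⟨fun v => by rw [AddSubgroup.mem_comap, map_nsmul]; exact hi.1 _,
      fun g hg v => by rw [AddSubgroup.mem_comap, map_sub, hf]; exact hi.2 g hg _⟩ s hs
  rwa [AddSubgroup.mem_comap, map_sub, map_intAct f hf] at this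

/-- On a quotient isomorphic to an ideal of `(ℤ/n)[G/U]`, an element of `Ẑ[[G]]` acts through
multiplication by its component at the level `(n, U)`. -/
theorem map_act_level (i : Level G) (f : V →+ LevelRing i) (hc : IsOpen (f.ker : Set V))
    (hf : ∀ (g : G) (v : V), f (g • v) = MonoidAlgebra.single (QuotientGroup.mk g) 1 * f v)
    (r : CompletedGroupRing G) (v : V) : f (act r v) = r.1 i * f v := by
  obtain ⟨s, hs⟩ := intRed_surjective i (r.1 i)
  have h1 := isAct_act r v f.ker hc
    (fun g v hv => by
      rw [AddMonoidHom.mem_ker] at hv ⊢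
      rw [hf, hv, mul_zero]) i
    ⟨fun v => by rw [AddMonoidHom.mem_ker, map_nsmul, level_nsmul_eq_zero],
      fun g hg v => by
        rw [AddMonoidHom.mem_ker, map_sub, hf, (QuotientGroup.eq_one_iff g).mpr hg,
          ← MonoidAlgebra.one_def, one_mul, sub_self]⟩ s hs
  rw [AddMonoidHom.mem_ker, map_sub, sub_eq_zero] at h1
  rw [h1, ← hs]
  clear h1 hs
  induction s using MonoidAlgebra.induction_linear with
  | zero => simp
  | add a b ha hb => rw [map_add, map_add, LinearMap.add_apply, map_add, ha, hb, add_mul]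
  | single g c =>
    rw [intAct_single, intRed_single, map_zsmul, hf, ← smul_mul_assoc]
    congr 1
    rw [MonoidAlgebra.smul_single, zsmul_eq_mul, mul_one]

end MapAct

/-! ### The universal property of `M̂` -/

section Universal

theorem derivedSeries_two_eq_bot {P Q : Type*} [Group P] [CommGroup Q] (f : P →* Q)
    (h : ∀ a ∈ f.ker, ∀ b ∈ f.ker, a * b = b * a) : derivedSeries P 2 = ⊥ := by
  have h1 : derivedSeries P 1 ≤ f.ker := by
    rw [derivedSeries_one]
    exact Abelianization.commutator_subset_ker f
  rw [derivedSeries_succ, eq_bot_iff, Subgroup.commutator_le]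
  intro a ha b hb
  exact Subgroup.mem_bot.mpr (commutatorElement_eq_one_iff_mul_comm.mpr (h a (h1 ha) b (h1 hb)))

/-- The images in `M̂` of the standard generators of the free group. -/
def stdGen (i : Fin 2) : MHat :=
  ProfiniteGrp.ProfiniteCompletion.etaFn (GrpCat.of FreeMetabelian)
    (QuotientGroup.mk (FreeGroup.of i))

theorem topGenerates_stdGen : TopGenerates stdGen := by
  let η : FreeGroup (Fin 2) →* MHat :=
    (ProfiniteGrp.ProfiniteCompletion.eta (GrpCat.of FreeMetabelian)).hom.comp
      (QuotientGroup.mk' _)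
  have h1 : Subgroup.closure (Set.range stdGen) = η.range := by
    rw [MonoidHom.range_eq_map, ← FreeGroup.closure_range_of, MonoidHom.map_closure,
      ← Set.range_comp]
    rfl
  have h2 : Dense (η.range : Set MHat) := by
    have h3 := ProfiniteGrp.ProfiniteCompletion.denseRange (GrpCat.of FreeMetabelian)
    refine h3.mono ?_
    rintro _ ⟨m, rfl⟩
    obtain ⟨w, rfl⟩ := QuotientGroup.mk_surjective m
    exact ⟨w, rfl⟩
  rw [TopGenerates, h1]
  exact SetLike.coe_injective h2.closure_eq

theorem exists_hom_stdGen {P : Type} [Group P] [TopologicalSpace P] [IsTopologicalGroup P]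
    [CompactSpace P] [TotallyDisconnectedSpace P] (hP : derivedSeries P 2 = ⊥) (y : Fin 2 → P) :
    ∃ f : MHat →ₜ* P, ∀ i, f (stdGen i) = y i := by
  let f₀ : FreeMetabelian →* P := QuotientGroup.lift _ (FreeGroup.lift y) (by
    intro w hw
    have := map_derivedSeries_le_derivedSeries (FreeGroup.lift y) 2 ⟨w, hw, rfl⟩
    rw [hP] at this
    exact Subgroup.mem_bot.mp this)
  let F := ProfiniteGrp.ProfiniteCompletion.lift (G := GrpCat.of FreeMetabelian)
    (P := ProfiniteGrp.of P) (GrpCat.ofHom f₀)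
  have hF := ProfiniteGrp.ProfiniteCompletion.lift_eta (G := GrpCat.of FreeMetabelian)
    (P := ProfiniteGrp.of P) (GrpCat.ofHom f₀)
  refine ⟨F.hom, fun i => ?_⟩
  have h := congrArg (fun φ : GrpCat.of FreeMetabelian ⟶ GrpCat.of P =>
    φ.hom (QuotientGroup.mk (FreeGroup.of i))) hF
  refine h.trans ?_
  change FreeGroup.lift y (FreeGroup.of i) = y i
  simp

/-- Any pair of topological generators is a basis of the free profinite metabelian group `M̂`. -/
theorem TopGenerates.exists_hom {x : Fin 2 → MHat} (hx : TopGenerates x) {P : Type} [Group P]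
    [TopologicalSpace P] [IsTopologicalGroup P] [CompactSpace P] [TotallyDisconnectedSpace P]
    (hP : derivedSeries P 2 = ⊥) (y : Fin 2 → P) : ∃ f : MHat →ₜ* P, ∀ i, f (x i) = y i := by
  obtain ⟨φ, hφ⟩ := exists_hom_stdGen derivedSeries_mHat x
  have hs : Function.Surjective φ := hx.surjective φ fun i => ⟨stdGen i, hφ i⟩
  have hi := topGenerates_stdGen.injective_of_surjective φ hs
  let α := ContAut.ofBijective φ ⟨hi, hs⟩
  obtain ⟨f, hf⟩ := exists_hom_stdGen hP y
  refine ⟨f.comp (α⁻¹).toEnd, fun i => ?_⟩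
  rw [← hφ i, ← hf i]
  exact congrArg f (ContinuousMulEquiv.symm_apply_apply α (stdGen i))

/-- The universal property for finite metabelian groups. -/
theorem TopGenerates.exists_hom_finite {x : Fin 2 → MHat} (hx : TopGenerates x) {P : Type}
    [Group P] [Finite P] (hP : derivedSeries P 2 = ⊥) (y : Fin 2 → P) :
    ∃ f : MHat →* P, IsOpen (f.ker : Set MHat) ∧ ∀ i, f (x i) = y i := by
  -- `P` becomes a profinite group with the discrete topology.
  let : TopologicalSpace P := ⊥
  have : DiscreteTopology P := ⟨rfl⟩
  obtain ⟨f, hf⟩ := hx.exists_hom hP y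
  exact ⟨f.toMonoidHom, (isOpen_discrete {(1 : P)}).preimage f.continuous_toFun, hf⟩

theorem derived_le_ker {Q : Type*} [CommGroup Q] (f : MHat →* Q)
    (hf : IsOpen (f.ker : Set MHat)) : Derived ≤ f.ker :=
  Subgroup.topologicalClosure_minimal _ (Abelianization.commutator_subset_ker f)
    (Subgroup.isClosed_of_isOpen _ hf)

/-- The images of topological generators of `M̂` form a basis of `Â`: they can be mapped to any
pair of elements of `ℤ/N`. -/
theorem TopGenerates.exists_character {x : Fin 2 → MHat} (hx : TopGenerates x) (N : ℕ) [NeZero N]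
    (y : Fin 2 → ZMod N) : ∃ χ : AHat →* Multiplicative (ZMod N), IsOpen (χ.ker : Set AHat) ∧
      ∀ i, χ (x i : AHat) = Multiplicative.ofAdd (y i) := by
  obtain ⟨f, hf, hfx⟩ := hx.exists_hom_finite (P := Multiplicative (ZMod N))
    (derivedSeries_two_eq_bot (MonoidHom.id _) fun a _ b _ => mul_comm a b)
    fun i => Multiplicative.ofAdd (y i)
  refine ⟨QuotientGroup.lift Derived f (derived_le_ker f hf), ?_, hfx⟩
  exact (QuotientGroup.isOpenQuotientMap_mk (N := Derived)).isQuotientMap.isOpen_preimage.mp hf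

theorem TopGenerates.ab {x : Fin 2 → MHat} (hx : TopGenerates x) :
    TopGenerates fun i => (x i : AHat) :=
  hx.map (QuotientGroup.mk' Derived) continuous_quot_mk (QuotientGroup.mk'_surjective _)

end Universal

/-! ### Regularity of `1 - a₁, 1 - a₂` -/

section Regular

/-- If `χ` maps `a` to a generator of `ℤ/kn`, where `k` is the index of `U`, then `a ^ k` has order
divisible by `n` modulo `U ∩ ker χ`, so that an element killed by `1 - a` at a level `(n, V)` with
`V ≤ U ∩ ker χ` vanishes at the level `(n, U)`. -/
theorem level_eq_zero_of_character {H : Type*} [CommGroup H] [TopologicalSpace H]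
    [IsTopologicalGroup H] [CompactSpace H] (i j : Level H) (a : H)
    (χ : H →* Multiplicative (ZMod (Nat.card (H ⧸ i.U.toSubgroup) * i.n)))
    (hχ : χ a = Multiplicative.ofAdd 1) (hn : j.n = i.n)
    (hV : j.U.toSubgroup ≤ i.U.toSubgroup ⊓ χ.ker) (r : CompletedGroupRing H)
    (hr : (r * (1 - of a)).1 j = 0) : r.1 i = 0 := by
  obtain ⟨m, V⟩ := j
  obtain rfl : m = i.n := hn
  have hpos : 0 < Nat.card (H ⧸ i.U.toSubgroup) := Nat.card_pos
  refine level_eq_zero_of_invariant i V (hV.trans inf_le_left) a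
    (Nat.card (H ⧸ i.U.toSubgroup)) ?_ ?_ r hr
  · refine (QuotientGroup.eq_one_iff (N := i.U.toSubgroup) _).mp ?_
    rw [QuotientGroup.mk_pow, pow_card_eq_one']
  · set m := orderOf (QuotientGroup.mk (a ^ Nat.card (H ⧸ i.U.toSubgroup)) : H ⧸ V.toSubgroup)
    have h1 : (QuotientGroup.mk (a ^ Nat.card (H ⧸ i.U.toSubgroup)) : H ⧸ V.toSubgroup) ^ m = 1 :=
      pow_orderOf_eq_one _
    rw [← QuotientGroup.mk_pow, ← pow_mul, QuotientGroup.eq_one_iff] at h1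
    have h2 := MonoidHom.mem_ker.mp (hV h1).2
    rw [map_pow, hχ, ← ofAdd_nsmul, nsmul_one, ofAdd_eq_one, ZMod.natCast_eq_zero_iff] at h2
    exact Nat.dvd_of_mul_dvd_mul_left hpos h2

variable {x : Fin 2 → MHat}

/-- The level `(n, U ∩ ker χ)`. -/
def Level.cut {H Q : Type*} [CommGroup H] [TopologicalSpace H] [Group Q] (i : Level H)
    (χ : H →* Q) (hχ : IsOpen (χ.ker : Set H)) : Level H :=
  ⟨i.n, { toSubgroup := i.U.toSubgroup ⊓ χ.ker
          isOpen' := i.U.isOpen.inter hχ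
          isNormal' := inferInstance }⟩

/-- An element vanishes at the level `(n, U)` if its product with `1 - aₖ` vanishes at all levels
whose subgroup contains the other generator whenever `U` does. -/
theorem TopGenerates.level_eq_zero (hx : TopGenerates x) (k : Fin 2) (i : Level AHat)
    (r : CompletedGroupRing AHat) (h : ∀ j : Level AHat,
      (∀ l, l ≠ k → (x l : AHat) ∈ i.U → (x l : AHat) ∈ j.U) →
        (r * (1 - of (x k : AHat))).1 j = 0) : r.1 i = 0 := by
  have : NeZero (Nat.card (AHat ⧸ i.U.toSubgroup) * (i.n : ℕ)) :=
    ⟨(Nat.mul_pos Nat.card_pos i.n.pos).ne'⟩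
  obtain ⟨χ, hχ, hχx⟩ := hx.exists_character (Nat.card (AHat ⧸ i.U.toSubgroup) * i.n)
    (Pi.single k 1)
  refine level_eq_zero_of_character i (i.cut χ hχ) (x k) χ (by simp [hχx]) rfl le_rfl r
    (h _ fun l hl hli => ⟨hli, ?_⟩)
  exact (hχx l).trans (by simp [Pi.single_eq_of_ne hl])

theorem TopGenerates.eq_zero_of_mul (hx : TopGenerates x) (k : Fin 2)
    (r : CompletedGroupRing AHat) (h : r * (1 - of (x k : AHat)) = 0) : r = 0 :=
  CompletedGroupRing.ext_level fun i => hx.level_eq_zero k i r fun j _ => by rw [h]; rfl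

/-- Exactness of the Koszul complex of `1 - a₁, 1 - a₂` in the middle. -/
theorem TopGenerates.koszul (hx : TopGenerates x) (s₀ s₁ : CompletedGroupRing AHat)
    (h : s₀ * (1 - of (x 1 : AHat)) = s₁ * (1 - of (x 0 : AHat))) :
    ∃ t, s₀ = t * (1 - of (x 0 : AHat)) ∧ s₁ = t * (1 - of (x 1 : AHat)) := by
  obtain ⟨t, t', ht⟩ := exists_eq_of_forall_level_eq_zero (x 0 : AHat) 1 s₀ fun i hi _ =>
    hx.level_eq_zero 1 i s₀ fun j hj => by
      have h0 : (x 0 : AHat) ∈ j.U := hj 0 (by decide) hi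
      rw [h]
      change s₁.1 j * (1 - MonoidAlgebra.single (QuotientGroup.mk (x 0 : AHat)) 1) = 0
      rw [(QuotientGroup.eq_one_iff (N := j.U.toSubgroup) _).mpr h0, ← MonoidAlgebra.one_def,
        sub_self, mul_zero]
  rw [map_one, sub_self, mul_zero, add_zero] at ht
  refine ⟨t, ht, ?_⟩
  rw [← sub_eq_zero]
  refine hx.eq_zero_of_mul 0 _ ?_
  rw [sub_mul, ← h, ht]
  ring

end Regular

/-! ### The module `M̂'` -/

namespace DerivedModule

theorem toElem_injective : Function.Injective toElem := fun _ _ h => Subtype.ext h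

theorem toElem_add (m n : DerivedModule) : toElem (m + n) = toElem m * toElem n := rfl

theorem toElem_neg (m : DerivedModule) : toElem (-m) = (toElem m)⁻¹ := rfl

theorem toElem_sub (m n : DerivedModule) : toElem (m - n) = toElem m * (toElem n)⁻¹ := by
  rw [sub_eq_add_neg, toElem_add, toElem_neg]

theorem toElem_zero : toElem 0 = 1 := rfl

theorem toElem_mem (m : DerivedModule) : toElem m ∈ Derived := Subtype.prop (p := (· ∈ Derived)) m

theorem toElem_comm (x y : MHat) : toElem (comm x y) = ⁅x, y⁆ := rfl

theorem continuous_toElem : Continuous toElem := continuous_subtype_val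

theorem exists_toElem {g : MHat} (hg : g ∈ Derived) : ∃ m, toElem m = g := ⟨ofElem ⟨g, hg⟩, rfl⟩

theorem of_smul (a : AHat) (m : DerivedModule) : of a • m = a • m := act_of a m

theorem toElem_of_smul (g : MHat) (m : DerivedModule) :
    toElem (of (g : AHat) • m) = g * toElem m * g⁻¹ := by
  rw [of_smul, toElem_smul]

theorem continuous_smul_left (m : DerivedModule) :
    Continuous fun r : CompletedGroupRing AHat => r • m := continuous_act m

end DerivedModule

open DerivedModule

theorem mk_toElem (m : DerivedModule) : (toElem m : AHat) = 1 :=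
  (QuotientGroup.eq_one_iff _).mpr (toElem_mem m)

section Free

/-- The action of `Q` by translations on the group ring `k[Q]`. -/
def groupRingAction (k Q : Type*) [Ring k] [Group Q] :
    Q →* MulAut (Multiplicative (MonoidAlgebra k Q)) where
  toFun q := AddEquiv.toMultiplicative
    { toFun := fun x => MonoidAlgebra.single q 1 * x
      invFun := fun x => MonoidAlgebra.single q⁻¹ 1 * x
      left_inv := fun x => by
        dsimp only
        rw [← mul_assoc, MonoidAlgebra.single_mul_single, inv_mul_cancel, one_mul,
          ← MonoidAlgebra.one_def, one_mul]
      right_inv := fun x => by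
        dsimp only
        rw [← mul_assoc, MonoidAlgebra.single_mul_single, mul_inv_cancel, one_mul,
          ← MonoidAlgebra.one_def, one_mul]
      map_add' := fun x y => mul_add _ x y }
  map_one' := by
    refine MulEquiv.ext fun x => ?_
    change MonoidAlgebra.single 1 1 * Multiplicative.toAdd x = _
    rw [← MonoidAlgebra.one_def, one_mul]
    rfl
  map_mul' a b := by
    refine MulEquiv.ext fun x => ?_
    change MonoidAlgebra.single (a * b) 1 * Multiplicative.toAdd x =
      MonoidAlgebra.single a 1 * (MonoidAlgebra.single b 1 * Multiplicative.toAdd x)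
    rw [← mul_assoc, MonoidAlgebra.single_mul_single, one_mul]

theorem semidirect_conj_left {N Q : Type*} [CommGroup N] [Group Q] {φ : Q →* MulAut N}
    (a b : N ⋊[φ] Q) (hb : b.right = 1) : (a * b * a⁻¹).left = φ a.right b.left := by
  simp [SemidirectProduct.mul_left, SemidirectProduct.mul_right, hb]

theorem semidirect_commutator_left {N Q : Type*} [CommGroup N] [CommGroup Q] {φ : Q →* MulAut N}
    (a b : Q) (n : N) : (⁅(⟨1, a⟩ : N ⋊[φ] Q), (⟨n, b⟩ : N ⋊[φ] Q)⁆).left = φ a n * n⁻¹ := by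
  simp [commutatorElement_def, SemidirectProduct.mul_left, SemidirectProduct.mul_right]

/-- A finite-level Magnus representation: the homomorphism from `M̂` to the metabelian group
`(ℤ/n)[Â/U] ⋊ Â/U` with `x₀ ↦ (0, a₀)`, `x₁ ↦ (1, a₁)` restricts to a map on `M̂'` which sends
`[x₀, x₁]` to `a₀ - 1`. -/
theorem TopGenerates.exists_magnus {x : Fin 2 → MHat} (hx : TopGenerates x) (i : Level AHat) :
    ∃ f : DerivedModule →+ LevelRing i, ∀ r : CompletedGroupRing AHat,
      f (r • comm (x 0) (x 1)) = (r * (of (x 0 : AHat) - 1)).1 i := by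
  let Q := AHat ⧸ i.U.toSubgroup
  let P := Multiplicative (LevelRing i) ⋊[groupRingAction (ZMod i.n) Q] Q
  have : Finite P := Finite.of_equiv _ SemidirectProduct.equivProd.symm
  have hP : derivedSeries P 2 = ⊥ := by
    refine derivedSeries_two_eq_bot (SemidirectProduct.rightHom (φ := groupRingAction (ZMod i.n) Q))
      fun a ha b hb => ?_
    rw [← SemidirectProduct.range_inl_eq_ker_rightHom] at ha hb
    obtain ⟨a, rfl⟩ := ha
    obtain ⟨b, rfl⟩ := hb
    rw [← map_mul, mul_comm, map_mul]
  obtain ⟨θ, hθ, hθx⟩ := hx.exists_hom_finite hP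
    ![⟨1, QuotientGroup.mk (x 0 : AHat)⟩, ⟨Multiplicative.ofAdd 1, QuotientGroup.mk (x 1 : AHat)⟩]
  have hx0 : θ (x 0) = ⟨1, QuotientGroup.mk (x 0 : AHat)⟩ := hθx 0
  have hx1 : θ (x 1) = ⟨Multiplicative.ofAdd 1, QuotientGroup.mk (x 1 : AHat)⟩ := hθx 1
  let p : MHat →* Q := (QuotientGroup.mk' i.U.toSubgroup).comp (QuotientGroup.mk' Derived)
  have hp : IsOpen (p.ker : Set MHat) := by
    have : (p.ker : Set MHat) = (QuotientGroup.mk : MHat → AHat) ⁻¹' (i.U : Set AHat) := by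
      ext g
      exact QuotientGroup.eq_one_iff (N := i.U.toSubgroup) (g : AHat)
    rw [this]
    exact i.U.toOpenSubgroup.isOpen.preimage continuous_quot_mk
  have hright : ∀ g, (θ g).right = p g := by
    intro g
    refine hx.mem_of_isClosed (K := (SemidirectProduct.rightHom.comp θ).eqLocus p)
      (Subgroup.isClosed_of_isOpen _ (Subgroup.isOpen_mono (H₁ := θ.ker ⊓ p.ker) ?_
        (hθ.inter hp))) ?_ g
    · intro g hg
      have h1 : θ g = 1 := hg.1
      have h2 : p g = 1 := hg.2
      change (θ g).right = p g
      rw [h1, h2]; rfl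
    · refine Fin.forall_fin_two.mpr ⟨?_, ?_⟩
      · change (θ (x 0)).right = _
        rw [hx0]; rfl
      · change (θ (x 1)).right = _
        rw [hx1]; rfl
  have hright1 : ∀ m : DerivedModule, (θ (toElem m)).right = 1 := fun m => by
    rw [hright]
    change QuotientGroup.mk (toElem m : AHat) = _
    rw [mk_toElem]; rfl
  let f : DerivedModule →+ LevelRing i :=
    { toFun := fun m => Multiplicative.toAdd (θ (toElem m)).left
      map_zero' := by rw [toElem_zero, map_one]; rfl
      map_add' := fun m n => by
        rw [toElem_add, map_mul, SemidirectProduct.mul_left, hright1, map_one]; rfl }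
  have hfker : IsOpen (f.ker : Set DerivedModule) := by
    have : (f.ker : Set DerivedModule) = toElem ⁻¹' (θ.ker : Set MHat) := by
      ext m
      exact ⟨fun h => SemidirectProduct.ext h (hright1 m),
        fun h => congrArg SemidirectProduct.left h⟩
    rw [this]
    exact hθ.preimage continuous_toElem
  have hfsmul : ∀ (g : AHat) (m : DerivedModule),
      f (g • m) = MonoidAlgebra.single (QuotientGroup.mk g) 1 * f m := by
    intro g m
    obtain ⟨g, rfl⟩ := QuotientGroup.mk_surjective g
    change Multiplicative.toAdd (θ (toElem ((g : AHat) • m))).left = _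
    rw [toElem_smul, map_mul, map_mul, map_inv, semidirect_conj_left _ _ (hright1 m), hright]
    rfl
  have hfc : f (comm (x 0) (x 1)) =
      MonoidAlgebra.single (QuotientGroup.mk (x 0 : AHat)) 1 - 1 := by
    change Multiplicative.toAdd (θ (toElem (comm (x 0) (x 1)))).left = _
    rw [toElem_comm, map_commutatorElement, hx0, hx1, semidirect_commutator_left]
    change MonoidAlgebra.single _ 1 * (1 : LevelRing i) + -1 = _
    rw [mul_one, sub_eq_add_neg]
  refine ⟨f, fun r => ?_⟩
  refine (map_act_level i f hfker hfsmul r _).trans ?_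
  rw [hfc]
  rfl

/-- `M̂'` is torsion-free on `[x₀, x₁]`. -/
theorem TopGenerates.smul_comm_eq_zero {x : Fin 2 → MHat} (hx : TopGenerates x)
    {r : CompletedGroupRing AHat} (h : r • comm (x 0) (x 1) = 0) : r = 0 := by
  refine hx.eq_zero_of_mul 0 r (CompletedGroupRing.ext_level fun i => ?_)
  obtain ⟨f, hf⟩ := hx.exists_magnus i
  have h1 := hf r
  rw [h, map_zero] at h1
  rw [← neg_sub, mul_neg]
  change -(r * (of (x 0 : AHat) - 1)).1 i = 0
  rw [← h1, neg_zero]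

theorem TopGenerates.smul_comm_injective {x : Fin 2 → MHat} (hx : TopGenerates x) :
    Function.Injective fun r : CompletedGroupRing AHat => r • comm (x 0) (x 1) := by
  intro r s h
  have h' : r • comm (x 0) (x 1) = s • comm (x 0) (x 1) := h
  refine sub_eq_zero.mp (hx.smul_comm_eq_zero ?_)
  rw [sub_smul, h', sub_self]

/-- A closed normal subgroup containing the commutator of the generators contains `M̂'`, since
the quotient is abelian. -/
theorem TopGenerates.derived_le {x : Fin 2 → MHat} (hx : TopGenerates x) (K : Subgroup MHat)
    [K.Normal] (hK : IsClosed (K : Set MHat)) (h : ⁅x 0, x 1⁆ ∈ K) : Derived ≤ K := by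
  -- `C g` consists of the elements commuting with `g` modulo `K`.
  let C : MHat → Subgroup MHat := fun g =>
    (Subgroup.centralizer {(g : MHat ⧸ K)}).comap (QuotientGroup.mk' K)
  have hC : ∀ g k, k ∈ C g ↔ ⁅g, k⁆ ∈ K := by
    intro g k
    rw [Subgroup.mem_comap, Subgroup.mem_centralizer_singleton_iff, ← QuotientGroup.eq_one_iff,
      eq_comm]
    change (g : MHat ⧸ K) * k = k * g ↔ _
    rw [← commutatorElement_eq_one_iff_mul_comm]
    rfl
  have hcl : ∀ g, IsClosed (C g : Set MHat) := by
    intro g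
    have : (C g : Set MHat) = (fun k => ⁅g, k⁆) ⁻¹' (K : Set MHat) := by
      ext k; exact hC g k
    rw [this]
    refine hK.preimage ?_
    simp only [commutatorElement_def]
    fun_prop
  have hsymm : ∀ g k, k ∈ C g → g ∈ C k := by
    intro g k hk
    rw [hC] at hk ⊢
    rw [← commutatorElement_inv]
    exact K.inv_mem hk
  have hself : ∀ g, g ∈ C g := fun g => by rw [hC, commutatorElement_self]; exact K.one_mem
  have h01 : x 1 ∈ C (x 0) := (hC _ _).mpr h
  have h1 : ∀ i g, g ∈ C (x i) := by
    refine Fin.forall_fin_two.mpr ⟨?_, ?_⟩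
    · exact hx.mem_of_isClosed (hcl _) (Fin.forall_fin_two.mpr ⟨hself _, h01⟩)
    · exact hx.mem_of_isClosed (hcl _) (Fin.forall_fin_two.mpr ⟨hsymm _ _ h01, hself _⟩)
  have h2 : ∀ g k, k ∈ C g := fun g =>
    hx.mem_of_isClosed (hcl g) fun i => hsymm _ _ (h1 i g)
  refine Subgroup.topologicalClosure_minimal _ ?_ hK
  rw [commutator_def, Subgroup.commutator_le]
  exact fun g _ k _ => (hC g k).mp (h2 g k)

/-- `M̂'` is generated by `[x₀, x₁]` as a module. -/
theorem TopGenerates.smul_comm_surjective {x : Fin 2 → MHat} (hx : TopGenerates x) :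
    Function.Surjective fun r : CompletedGroupRing AHat => r • comm (x 0) (x 1) := by
  let c := comm (x 0) (x 1)
  let K : Subgroup MHat :=
    { carrier := Set.range fun r : CompletedGroupRing AHat => toElem (r • c)
      one_mem' := ⟨0, by simp only [zero_smul, toElem_zero]⟩
      mul_mem' := by
        rintro _ _ ⟨r, rfl⟩ ⟨s, rfl⟩
        exact ⟨r + s, by simp only [add_smul, toElem_add]⟩
      inv_mem' := by
        rintro _ ⟨r, rfl⟩
        exact ⟨-r, by simp only [neg_smul, toElem_neg]⟩ }
  have hK : K.Normal := ⟨by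
    rintro _ ⟨r, rfl⟩ g
    exact ⟨of (g : AHat) * r, by simp only [mul_smul, toElem_of_smul]⟩⟩
  have hcl : IsClosed (K : Set MHat) :=
    (isCompact_range (continuous_toElem.comp (continuous_smul_left c))).isClosed
  intro m
  obtain ⟨r, hr⟩ := hx.derived_le K hcl ⟨1, by simp only [one_smul]; rfl⟩ (toElem_mem m)
  exact ⟨r, toElem_injective hr⟩

/-- `M̂'` is a free module of rank one on `[x₀, x₁]`. -/
def TopGenerates.freeHomeomorph {x : Fin 2 → MHat} (hx : TopGenerates x) :
    CompletedGroupRing AHat ≃ₜ DerivedModule :=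
  (isHomeomorph_iff_continuous_bijective.mpr ⟨continuous_smul_left (comm (x 0) (x 1)),
    hx.smul_comm_injective, hx.smul_comm_surjective⟩).homeomorph

end Free

/-! ### IA-endomorphisms and their determinants -/

section IA

theorem isIAEnd_iff {γ : MHat →ₜ* MHat} : IsIAEnd γ ↔ ∀ g, (γ g : AHat) = g := by
  refine ⟨fun h g => DFunLike.congr_fun (h : abEnd γ = _) (g : AHat), fun h => ?_⟩
  refine MonoidHom.ext fun a => ?_
  obtain ⟨g, rfl⟩ := QuotientGroup.mk_surjective a
  exact h g

theorem continuous_mk_ab : Continuous fun g : MHat => (g : AHat) := continuous_quot_mk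

theorem IsIAEnd.of_generators {x : Fin 2 → MHat} (hx : TopGenerates x) {γ : MHat →ₜ* MHat}
    (h : ∀ i, (γ (x i) : AHat) = x i) : IsIAEnd γ := by
  rw [isIAEnd_iff]
  have hc : IsClosed {g : MHat | (γ g : AHat) = (g : AHat)} :=
    isClosed_eq (X := AHat) (continuous_mk_ab.comp γ.continuous_toFun) continuous_mk_ab
  exact hx.mem_of_isClosed
    (K := ((QuotientGroup.mk' Derived).comp γ.toMonoidHom).eqLocus (QuotientGroup.mk' Derived))
    hc h

theorem IsGamma.isIAEnd {x : Fin 2 → MHat} (hx : TopGenerates x)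
    {r : Fin 2 → CompletedGroupRing AHat} {γ : MHat →ₜ* MHat} (h : IsGamma x r γ) :
    IsIAEnd γ :=
  .of_generators hx fun i => by rw [h i, QuotientGroup.mk_mul, mk_toElem, one_mul]

theorem TopGenerates.exists_isGamma {x : Fin 2 → MHat} (hx : TopGenerates x)
    (r : Fin 2 → CompletedGroupRing AHat) : ∃ γ : MHat →ₜ* MHat, IsGamma x r γ :=
  hx.exists_hom derivedSeries_mHat _

theorem IsIAEnd.exists_isGamma {x : Fin 2 → MHat} (hx : TopGenerates x) {γ : MHat →ₜ* MHat}
    (h : IsIAEnd γ) : ∃ r, IsGamma x r γ := by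
  have h1 : ∀ i, ∃ r : CompletedGroupRing AHat,
      toElem (r • comm (x 0) (x 1)) = γ (x i) * (x i)⁻¹ := by
    intro i
    have h2 : γ (x i) * (x i)⁻¹ ∈ Derived := by
      rw [← QuotientGroup.eq_one_iff, QuotientGroup.mk_mul, QuotientGroup.mk_inv,
        isIAEnd_iff.mp h, mul_inv_cancel]
    obtain ⟨m, hm⟩ := exists_toElem h2
    obtain ⟨r, hr⟩ := hx.smul_comm_surjective m
    exact ⟨r, by rw [← hm, ← hr]⟩
  choose r hr using h1
  exact ⟨r, fun i => by rw [hr, inv_mul_cancel_right]⟩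

theorem IsGamma.unique {x : Fin 2 → MHat} (hx : TopGenerates x)
    {r s : Fin 2 → CompletedGroupRing AHat} {γ : MHat →ₜ* MHat} (hr : IsGamma x r γ)
    (hs : IsGamma x s γ) : r = s := by
  funext i
  exact hx.smul_comm_injective (toElem_injective (mul_right_cancel ((hr i).symm.trans (hs i))))

/-- The restriction of an endomorphism to `M̂'`. -/
def derivedMap (γ : MHat →ₜ* MHat) : DerivedModule →+ DerivedModule where
  toFun m := ofElem ⟨γ (toElem m), map_commutator_closure γ (toElem_mem m)⟩
  map_zero' := toElem_injective (map_one γ)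
  map_add' _ _ := toElem_injective (map_mul γ _ _)

theorem toElem_derivedMap (γ : MHat →ₜ* MHat) (m : DerivedModule) :
    toElem (derivedMap γ m) = γ (toElem m) := rfl

theorem continuous_derivedMap (γ : MHat →ₜ* MHat) : Continuous (derivedMap γ) :=
  (γ.continuous_toFun.comp continuous_toElem).subtype_mk _

theorem derivedMap_comm (γ : MHat →ₜ* MHat) (x y : MHat) :
    derivedMap γ (comm x y) = comm (γ x) (γ y) :=
  toElem_injective (map_commutatorElement γ x y)

theorem IsIAEnd.derivedMap_smul {γ : MHat →ₜ* MHat} (h : IsIAEnd γ)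
    (r : CompletedGroupRing AHat) (m : DerivedModule) :
    derivedMap γ (r • m) = r • derivedMap γ m := by
  refine map_act (derivedMap γ) (continuous_derivedMap γ) (fun a m => ?_) r m
  obtain ⟨g, rfl⟩ := QuotientGroup.mk_surjective a
  apply toElem_injective
  conv_rhs => rw [← isIAEnd_iff.mp h g]
  rw [toElem_derivedMap]
  change γ (toElem ((g : AHat) • m)) = toElem ((γ g : AHat) • derivedMap γ m)
  rw [toElem_smul, toElem_smul, map_mul, map_mul, map_inv, toElem_derivedMap]

/-- The commutator identity behind the Bachmuth determinant. -/
theorem comm_mul_mul (u v : DerivedModule) (x y : MHat) :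
    comm (toElem u * x) (toElem v * y) =
      comm x y + (u - of (y : AHat) • u) + (of (x : AHat) • v - v) := by
  have hxy : (y : AHat) = ((x * y * x⁻¹ : MHat) : AHat) := by
    rw [QuotientGroup.mk_mul, QuotientGroup.mk_mul, QuotientGroup.mk_inv, mul_comm (x : AHat),
      mul_inv_cancel_right]
  have h : comm x y + (u - of (y : AHat) • u) + (of (x : AHat) • v - v) =
      u + of (x : AHat) • v - of ((x * y * x⁻¹ : MHat) : AHat) • u + comm x y - v := by
    rw [← hxy]; abel
  rw [h]
  apply toElem_injective
  rw [toElem_sub, toElem_add, toElem_sub, toElem_add, toElem_of_smul, toElem_of_smul,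
    toElem_comm, toElem_comm, commutatorElement_def, commutatorElement_def]
  group

theorem IsGamma.derivedMap_comm {x : Fin 2 → MHat} {r : Fin 2 → CompletedGroupRing AHat}
    {γ : MHat →ₜ* MHat} (h : IsGamma x r γ) :
    derivedMap γ (comm (x 0) (x 1)) = bachmuthDet x r • comm (x 0) (x 1) := by
  rw [ProMetabelian.derivedMap_comm, h 0, h 1, comm_mul_mul]
  simp only [← mul_smul, bachmuthDet, add_smul, one_smul, sub_smul, mul_sub, mul_one]
  rw [mul_comm (r 0), mul_comm (r 1)]

/-- The determinant of an IA-endomorphism `γ`: the element through which `γ` acts on the free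
module `M̂'` of rank one. The definition makes sense for every endomorphism, and its value is the
scalar by which the commutator of the standard generators is multiplied. -/
def iaDet (γ : MHat →ₜ* MHat) : CompletedGroupRing AHat :=
  topGenerates_stdGen.freeHomeomorph.symm (derivedMap γ (comm (stdGen 0) (stdGen 1)))

theorem iaDet_smul_comm (γ : MHat →ₜ* MHat) :
    iaDet γ • comm (stdGen 0) (stdGen 1) = derivedMap γ (comm (stdGen 0) (stdGen 1)) :=
  topGenerates_stdGen.freeHomeomorph.apply_symm_apply _

theorem IsIAEnd.derivedMap_eq {γ : MHat →ₜ* MHat} (h : IsIAEnd γ) (m : DerivedModule) :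
    derivedMap γ m = iaDet γ • m := by
  obtain ⟨r, rfl⟩ := topGenerates_stdGen.smul_comm_surjective m
  simp only
  rw [h.derivedMap_smul, ← iaDet_smul_comm, smul_smul, smul_smul, mul_comm]

theorem iaDet_eq {γ : MHat →ₜ* MHat} {d : CompletedGroupRing AHat}
    (h : ∀ m, derivedMap γ m = d • m) : iaDet γ = d :=
  topGenerates_stdGen.smul_comm_injective ((iaDet_smul_comm γ).trans (h _))

/-- The determinant does not depend on the generators. -/
theorem IsGamma.iaDet_eq {x : Fin 2 → MHat} (hx : TopGenerates x)
    {r : Fin 2 → CompletedGroupRing AHat} {γ : MHat →ₜ* MHat} (h : IsGamma x r γ) :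
    iaDet γ = bachmuthDet x r :=
  hx.smul_comm_injective (((h.isIAEnd hx).derivedMap_eq _).symm.trans h.derivedMap_comm)

theorem IsIAEnd.comp {γ δ : MHat →ₜ* MHat} (hγ : IsIAEnd γ) (hδ : IsIAEnd δ) :
    IsIAEnd (γ.comp δ) :=
  isIAEnd_iff.mpr fun g => (isIAEnd_iff.mp hγ (δ g)).trans (isIAEnd_iff.mp hδ g)

theorem IsIAEnd.iaDet_comp {γ δ : MHat →ₜ* MHat} (hγ : IsIAEnd γ) (hδ : IsIAEnd δ) :
    iaDet (γ.comp δ) = iaDet γ * iaDet δ := by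
  refine ProMetabelian.iaDet_eq fun m => ?_
  change derivedMap γ (derivedMap δ m) = _
  rw [hδ.derivedMap_eq, hγ.derivedMap_eq, mul_smul]

theorem IsIAEnd.aug_iaDet {γ : MHat →ₜ* MHat} (h : IsIAEnd γ) : aug (iaDet γ) = 1 := by
  obtain ⟨r, hr⟩ := h.exists_isGamma topGenerates_stdGen
  rw [hr.iaDet_eq topGenerates_stdGen, bachmuthDet]
  simp only [map_add, map_mul, map_sub, map_one, aug_of, sub_self, mul_zero, add_zero]

theorem isIAEnd_conj (g : MHat) : IsIAEnd (conj MHat g).toEnd := by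
  refine isIAEnd_iff.mpr fun k => ?_
  change ((g * k * g⁻¹ : MHat) : AHat) = k
  rw [QuotientGroup.mk_mul, QuotientGroup.mk_mul, QuotientGroup.mk_inv, mul_comm (g : AHat),
    mul_inv_cancel_right]

theorem iaDet_conj (g : MHat) : iaDet (conj MHat g).toEnd = of (g : AHat) :=
  iaDet_eq fun m => toElem_injective (toElem_of_smul g m).symm

/-- An IA-endomorphism of determinant `1` is conjugation by an element of `M̂'`: by the exactness
of the Koszul complex, the corresponding pair `(r₀, r₁)` is a multiple of `(1 - a₀, 1 - a₁)`. -/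
theorem IsIAEnd.isInner_of_iaDet_eq_one {γ : MHat →ₜ* MHat} (h : IsIAEnd γ)
    (hd : iaDet γ = 1) : IsInner γ := by
  have hx := topGenerates_stdGen
  obtain ⟨r, hr⟩ := h.exists_isGamma hx
  rw [hr.iaDet_eq hx, bachmuthDet] at hd
  obtain ⟨t, h0, h1⟩ := hx.koszul (r 0) (r 1) (by linear_combination hd)
  have hrt : ∀ i, r i = t * (1 - of (stdGen i : AHat)) := Fin.forall_fin_two.mpr ⟨h0, h1⟩
  refine ⟨toElem (t • comm (stdGen 0) (stdGen 1)), hx.hom_ext fun i => ?_⟩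
  rw [hr i, hrt i, mul_comm, mul_smul, sub_smul, one_smul, toElem_sub, toElem_of_smul]
  change _ = _ * stdGen i * _
  group

theorem IsIAEnd.isInner_iff {γ : MHat →ₜ* MHat} (h : IsIAEnd γ) :
    IsInner γ ↔ iaDet γ ∈ Set.range (of : AHat → CompletedGroupRing AHat) := by
  constructor
  · rintro ⟨g, rfl⟩
    exact ⟨g, (iaDet_conj g).symm⟩
  · rintro ⟨a, ha⟩
    obtain ⟨g, rfl⟩ := QuotientGroup.mk_surjective a
    have h1 := (isIAEnd_conj g⁻¹).comp h
    obtain ⟨k, hk⟩ := h1.isInner_of_iaDet_eq_one (by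
      rw [(isIAEnd_conj g⁻¹).iaDet_comp h, iaDet_conj, ← ha, ← map_mul, QuotientGroup.mk_inv,
        inv_mul_cancel, map_one])
    refine ⟨g * k, ?_⟩
    ext m
    have h2 : g⁻¹ * γ m * g⁻¹⁻¹ = k * m * k⁻¹ := DFunLike.congr_fun hk m
    change γ m = g * k * m * (g * k)⁻¹
    have h3 : γ m = g * (g⁻¹ * γ m * g⁻¹⁻¹) * g⁻¹ := by group
    rw [h3, h2]
    group

end IA

/-! ### Topology of automorphism groups -/

namespace ContAut

variable {G : Type*} [Group G] [TopologicalSpace G]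

/-- The inclusion of the automorphisms in the continuous maps. -/
def toMap (f : ContAut G) : C(G, G) := ⟨f, f.continuous⟩

theorem continuous_toMap : Continuous (toMap (G := G)) := continuous_induced_dom

theorem continuous_apply (g : G) : Continuous fun f : ContAut G => f g :=
  (ContinuousEvalConst.continuous_eval_const (F := C(G, G)) g).comp continuous_toMap

theorem continuous_uncurry [LocallyCompactSpace G] :
    Continuous fun p : ContAut G × G => p.1 p.2 :=
  (ContinuousEval.continuous_eval (F := C(G, G))).comp
    ((continuous_toMap.comp continuous_fst).prodMk continuous_snd)

/-- A family of automorphisms is continuous for the compact-open topology if it is jointly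
continuous. -/
theorem continuous_of_uncurry {X : Type*} [TopologicalSpace X] (f : X → ContAut G)
    (hf : Continuous fun p : X × G => f p.1 p.2) : Continuous f :=
  continuous_induced_rng.mpr
    (ContinuousMap.continuous_of_continuous_uncurry (fun x => toMap (f x)) hf)

instance [LocallyCompactSpace G] : ContinuousMul (ContAut G) :=
  ⟨continuous_of_uncurry _ (continuous_uncurry.comp
    ((continuous_fst.comp continuous_fst).prodMk
      (continuous_uncurry.comp ((continuous_snd.comp continuous_fst).prodMk continuous_snd))))⟩

instance [T2Space G] : T2Space (ContAut G) :=
  T2Space.of_injective_continuous (f := toMap)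
    (fun _ _ h => ContAut.ext fun x => DFunLike.congr_fun h x) continuous_toMap

theorem toEnd_injective : Function.Injective (toEnd (G := G)) :=
  fun _ _ h => ContAut.ext fun x => DFunLike.congr_fun h x

end ContAut

section AbTopology

variable (G : Type*) [Group G] [TopologicalSpace G] [IsTopologicalGroup G]

theorem continuous_abAut [LocallyCompactSpace G] : Continuous (abAut G) := by
  refine ContAut.continuous_of_uncurry _ ?_
  have hq : IsOpenQuotientMap (Prod.map (id : ContAut G → ContAut G)
      (QuotientGroup.mk : G → TopologicalAbelianization G)) :=
    IsOpenQuotientMap.id.prodMap QuotientGroup.isOpenQuotientMap_mk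
  rw [hq.isQuotientMap.continuous_iff]
  exact continuous_quot_mk.comp ContAut.continuous_uncurry

theorem continuous_abStar [LocallyCompactSpace G] : Continuous (abStar G) :=
  continuous_quot_lift _ (continuous_abAut G)

end AbTopology

/-! ### Compactness of the automorphism group of `M̂` -/

/-- The endomorphism of `M̂` with prescribed values at the standard generators. -/
def endo (y : Fin 2 → MHat) : MHat →ₜ* MHat :=
  (topGenerates_stdGen.exists_hom derivedSeries_mHat y).choose

theorem endo_stdGen (y : Fin 2 → MHat) (i : Fin 2) : endo y (stdGen i) = y i :=
  (topGenerates_stdGen.exists_hom derivedSeries_mHat y).choose_spec i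

theorem endo_apply_stdGen (γ : MHat →ₜ* MHat) : endo (fun i => γ (stdGen i)) = γ :=
  topGenerates_stdGen.hom_ext fun i => endo_stdGen _ i

/-- Modulo an open normal subgroup `U`, the endomorphism `endo y` depends only on `y` modulo `U`,
which makes the evaluation jointly continuous. -/
theorem continuous_endo : Continuous fun p : (Fin 2 → MHat) × MHat => endo p.1 p.2 := by
  rw [continuous_iff_continuousAt]
  rintro ⟨y₀, g₀⟩
  refine continuousAt_def.mpr fun A hA => ?_
  obtain ⟨S, hSA, hS, hrS⟩ := mem_nhds_iff.mp hA
  obtain ⟨U, hU⟩ := ProfiniteGrp.exist_openNormalSubgroup_sub_open_nhds_of_one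
    (hS.preimage (continuous_const_mul (endo y₀ g₀)))
    (by rw [Set.mem_preimage, mul_one]; exact hrS)
  have hUo : IsOpen (U : Set MHat) := U.toOpenSubgroup.isOpen
  have h1 : ∀ᶠ p : (Fin 2 → MHat) × MHat in nhds (y₀, g₀), ∀ i, (y₀ i)⁻¹ * p.1 i ∈ U :=
    Filter.eventually_all.mpr fun i =>
      (hUo.preimage (f := fun p : (Fin 2 → MHat) × MHat => (y₀ i)⁻¹ * p.1 i)
        (by fun_prop)).mem_nhds (by simp [one_mem])
  have h2 : ∀ᶠ p : (Fin 2 → MHat) × MHat in nhds (y₀, g₀),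
      (endo y₀ g₀)⁻¹ * endo y₀ p.2 ∈ U :=
    (hUo.preimage (f := fun p : (Fin 2 → MHat) × MHat => (endo y₀ g₀)⁻¹ * endo y₀ p.2)
      (continuous_const.mul ((endo y₀).continuous_toFun.comp continuous_snd))).mem_nhds
      (by simp [one_mem])
  filter_upwards [h1, h2] with p hp1 hp2
  let π := QuotientGroup.mk' U.toSubgroup
  have hcl : IsClosed ((π.comp (endo p.1).toMonoidHom).eqLocus
      (π.comp (endo y₀).toMonoidHom) : Set MHat) := by
    have hker : ∀ y, IsOpen ((π.comp (endo y).toMonoidHom).ker : Set MHat) := fun y => by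
      have : ((π.comp (endo y).toMonoidHom).ker : Set MHat) = endo y ⁻¹' (U : Set MHat) := by
        ext g
        exact QuotientGroup.eq_one_iff (N := U.toSubgroup) (endo y g)
      rw [this]
      exact hUo.preimage (endo y).continuous_toFun
    refine Subgroup.isClosed_of_isOpen _ (Subgroup.isOpen_mono
      (H₁ := (π.comp (endo p.1).toMonoidHom).ker ⊓ (π.comp (endo y₀).toMonoidHom).ker) ?_
      ((hker _).inter (hker _)))
    exact fun g hg => (MonoidHom.mem_ker.mp hg.1).trans (MonoidHom.mem_ker.mp hg.2).symm
  have h3 : π (endo p.1 p.2) = π (endo y₀ p.2) :=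
    topGenerates_stdGen.mem_of_isClosed hcl (fun i => by
      change π (endo p.1 (stdGen i)) = π (endo y₀ (stdGen i))
      rw [endo_stdGen, endo_stdGen]
      exact (QuotientGroup.eq.mpr (hp1 i)).symm) p.2
  have h4 : π (endo y₀ g₀) = π (endo p.1 p.2) := h3 ▸ QuotientGroup.eq.mpr hp2
  have h5 := hU (QuotientGroup.eq.mp h4)
  rw [Set.mem_preimage, mul_inv_cancel_left] at h5
  exact hSA h5

instance : CompactSpace (ContAut MHat) := by
  -- `Z` is the closed set of pairs of mutually inverse endomorphisms, given by the images of the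
  -- standard generators.
  let Z : Set ((Fin 2 → MHat) × (Fin 2 → MHat)) :=
    {p | ∀ i, endo p.1 (p.2 i) = stdGen i ∧ endo p.2 (p.1 i) = stdGen i}
  have hZ : IsClosed Z := by
    simp only [Z, Set.ofPred_forall]
    refine isClosed_iInter fun i => IsClosed.inter (isClosed_eq ?_ continuous_const)
      (isClosed_eq ?_ continuous_const)
    · exact continuous_endo.comp
        (continuous_fst.prodMk ((_root_.continuous_apply i).comp continuous_snd))
    · exact continuous_endo.comp
        (continuous_snd.prodMk ((_root_.continuous_apply i).comp continuous_fst))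
  have : CompactSpace Z := isCompact_iff_compactSpace.mp hZ.isCompact
  have hinv : ∀ p q : Fin 2 → MHat, (∀ i, endo p (q i) = stdGen i) →
      ∀ g, endo p (endo q g) = g := by
    intro p q h g
    have : (endo p).comp (endo q) = ContinuousMonoidHom.id MHat :=
      topGenerates_stdGen.hom_ext fun i => by
        change endo p (endo q (stdGen i)) = stdGen i
        rw [endo_stdGen, h]
    exact DFunLike.congr_fun this g
  let F : Z → ContAut MHat := fun p =>
    ({ toFun := endo p.1.1
       invFun := endo p.1.2
       left_inv := hinv _ _ fun i => (p.2 i).2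
       right_inv := hinv _ _ fun i => (p.2 i).1
       map_mul' := map_mul _
       continuous_toFun := (endo p.1.1).continuous_toFun
       continuous_invFun := (endo p.1.2).continuous_toFun } : MHat ≃ₜ* MHat)
  have hF : Continuous F := ContAut.continuous_of_uncurry F
    (continuous_endo.comp (((continuous_fst.comp continuous_subtype_val).comp
      continuous_fst).prodMk continuous_snd))
  have hs : Function.Surjective F := by
    intro α
    have h1 := endo_apply_stdGen α.toEnd
    have h2 := endo_apply_stdGen (α⁻¹).toEnd
    refine ⟨⟨(fun i => α.toEnd (stdGen i), fun i => (α⁻¹).toEnd (stdGen i)), fun i => ?_⟩, ?_⟩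
    · simp only [h1, h2]
      exact ⟨ContinuousMulEquiv.apply_symm_apply α _, ContinuousMulEquiv.symm_apply_apply α _⟩
    · exact ContAut.ext fun g => DFunLike.congr_fun h1 g
  exact ⟨by rw [← hs.range_eq]; exact isCompact_range hF⟩

/-! ### The determinant on outer automorphisms -/

section Units

/-- The units of a compact Hausdorff ring carry the subspace topology. -/
theorem isClosedEmbedding_units_val {R : Type*} [Ring R] [TopologicalSpace R]
    [IsTopologicalRing R] [CompactSpace R] [T2Space R] :
    Topology.IsClosedEmbedding (Units.val : Rˣ → R) :=
  Units.continuous_val.isClosedEmbedding Units.val_injective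

variable {G : Type*} [Group G] [TopologicalSpace G]

theorem mem_specialUnits {u : (CompletedGroupRing G)ˣ} :
    u ∈ SpecialUnits G ↔ aug (u : CompletedGroupRing G) = 1 := by
  rw [SpecialUnits, MonoidHom.mem_ker, ← Units.val_inj]
  rfl

theorem continuous_ofSpecial [IsTopologicalGroup G] [CompactSpace G] :
    Continuous (ofSpecial (G := G)) := by
  have h : Continuous fun g : G => Units.map (of (G := G)) (toUnits g) :=
    isClosedEmbedding_units_val.continuous_iff.mpr continuous_of
  exact h.subtype_mk _

instance {H : Type*} [CommGroup H] [TopologicalSpace H] [IsTopologicalGroup H] [CompactSpace H] :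
    T2Space (SpecialUnitsMod H) := by
  have : IsClosed ((ofSpecial (G := H)).range : Set (SpecialUnits H)) :=
    (isCompact_range continuous_ofSpecial).isClosed
  exact inferInstanceAs (T2Space (SpecialUnits H ⧸ (ofSpecial (G := H)).range))

/-- Over the trivial quotient the augmentation is injective. -/
theorem levelAug_topLevel_injective (n : ℕ+) :
    Function.Injective (levelAug (topLevel G n)) := by
  have h : ∀ x : LevelRing (topLevel G n),
      x = MonoidAlgebra.single 1 (levelAug (topLevel G n) x) := by
    intro x
    induction x using MonoidAlgebra.induction_linear with
    | zero => rw [map_zero, MonoidAlgebra.single_zero]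
    | add a b ha hb => rw [map_add, MonoidAlgebra.single_add, ← ha, ← hb]
    | single q c =>
      obtain ⟨g, rfl⟩ := QuotientGroup.mk_surjective q
      have : (QuotientGroup.mk g : G ⧸ (topLevel G n).U.toSubgroup) = 1 :=
        (QuotientGroup.eq_one_iff g).mpr (Subgroup.mem_top g)
      rw [this]
      simp [levelAug]
  intro x y hxy
  rw [h x, h y, hxy]

theorem level_top_eq_zero {s : CompletedGroupRing G} (hs : aug s = 0) (i : Level G)
    (hi : i.U.toSubgroup = ⊤) : s.1 i = 0 := by
  have h : i = topLevel G i.n := by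
    obtain ⟨n, U⟩ := i
    exact congrArg (Level.mk n) (OpenNormalSubgroup.toSubgroup_injective hi)
  rw [h]
  refine levelAug_topLevel_injective _ ?_
  rw [map_zero]
  exact congrFun (congrArg Subtype.val hs) i.n

end Units

/-- The augmentation ideal is generated by `1 - a₀` and `1 - a₁`, so every element of augmentation
`1` is a Bachmuth determinant. -/
theorem TopGenerates.exists_bachmuthDet_eq {x : Fin 2 → MHat} (hx : TopGenerates x)
    {u : CompletedGroupRing AHat} (hu : aug u = 1) : ∃ r, bachmuthDet x r = u := by
  obtain ⟨t, t', h⟩ := exists_eq_of_forall_level_eq_zero (x 0 : AHat) (x 1 : AHat) (u - 1)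
    fun i h0 h1 => level_top_eq_zero (by rw [map_sub, hu, map_one, sub_self]) i <|
      (Subgroup.eq_top_iff' _).mpr <| hx.ab.mem_of_isClosed
        (Subgroup.isClosed_of_isOpen _ i.U.isOpen) (Fin.forall_fin_two.mpr ⟨h0, h1⟩)
  refine ⟨![t', -t], ?_⟩
  simp only [bachmuthDet, Matrix.cons_val_zero, Matrix.cons_val_one]
  linear_combination -h

/-- An IA-endomorphism with invertible determinant is bijective on `M̂'` and on `M̂/M̂'`. -/
theorem IsIAEnd.bijective_of_isUnit {γ : MHat →ₜ* MHat} (h : IsIAEnd γ)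
    (hu : IsUnit (iaDet γ)) : Function.Bijective γ := by
  obtain ⟨u, hu⟩ := hu
  constructor
  · refine (injective_iff_map_eq_one γ).mpr fun g hg => ?_
    have h1 : g ∈ Derived := by
      rw [← QuotientGroup.eq_one_iff, ← isIAEnd_iff.mp h g, hg, QuotientGroup.mk_one]
    obtain ⟨m, rfl⟩ := exists_toElem h1
    have h2 : u.val • m = 0 := by
      rw [hu, ← h.derivedMap_eq]
      exact toElem_injective hg
    have h3 : m = 0 := by
      rw [← one_smul (CompletedGroupRing AHat) m, ← u.inv_mul, mul_smul, h2, smul_zero]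
    rw [h3, toElem_zero]
  · intro g
    have h1 : (γ g)⁻¹ * g ∈ Derived := QuotientGroup.eq.mp (isIAEnd_iff.mp h g)
    obtain ⟨m, hm⟩ := exists_toElem h1
    refine ⟨g * toElem (u⁻¹.val • m), ?_⟩
    rw [map_mul, ← toElem_derivedMap, h.derivedMap_eq, ← hu, smul_smul, u.mul_inv, one_smul, hm,
      mul_inv_cancel_left]

/-- The group `IAut(M̂)`, as the preimage of `IOut(M̂)`. -/
def IAut : Subgroup (ContAut MHat) := (IOut MHat).comap (QuotientGroup.mk' (Inn MHat))

theorem mem_iAut_iff {γ : ContAut MHat} : γ ∈ IAut ↔ IsIAEnd γ.toEnd := by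
  constructor
  · intro h
    refine isIAEnd_iff.mpr fun g => ?_
    exact DFunLike.congr_fun (show abAut MHat γ = 1 from h) (g : AHat)
  · intro h
    refine ContAut.ext fun a => ?_
    obtain ⟨g, rfl⟩ := QuotientGroup.mk_surjective a
    exact isIAEnd_iff.mp h g

theorem isIAEnd_of_iAut (γ : IAut) : IsIAEnd γ.1.toEnd := mem_iAut_iff.mp γ.2

/-- The determinant on `IAut(M̂)`. -/
def detHom : IAut →* SpecialUnits AHat :=
  (MonoidHom.toHomUnits
    { toFun := fun γ : IAut => iaDet γ.1.toEnd
      map_one' := iaDet_eq fun m => (one_smul _ m).symm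
      map_mul' := fun γ δ => (isIAEnd_of_iAut γ).iaDet_comp (isIAEnd_of_iAut δ) }).codRestrict _
    fun γ => mem_specialUnits.mpr (isIAEnd_of_iAut γ).aug_iaDet

theorem continuous_detHom : Continuous detHom := by
  have h1 : Continuous fun γ : IAut => derivedMap γ.1.toEnd (comm (stdGen 0) (stdGen 1)) :=
    ((ContAut.continuous_apply (toElem (comm (stdGen 0) (stdGen 1)))).comp
      continuous_subtype_val).subtype_mk _
  have h2 : Continuous fun γ : IAut => iaDet γ.1.toEnd :=
    topGenerates_stdGen.freeHomeomorph.symm.continuous.comp h1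
  have h3 : Continuous fun γ : IAut => (detHom γ : (CompletedGroupRing AHat)ˣ) :=
    isClosedEmbedding_units_val.continuous_iff.mpr h2
  exact continuous_induced_rng.mpr h3

theorem exists_iaDet_eq {u : CompletedGroupRing AHat} (hu : aug u = 1) :
    ∃ γ : MHat →ₜ* MHat, IsIAEnd γ ∧ iaDet γ = u := by
  have hx := topGenerates_stdGen
  obtain ⟨r, hr⟩ := hx.exists_bachmuthDet_eq hu
  obtain ⟨γ, hγ⟩ := hx.exists_isGamma r
  exact ⟨γ, hγ.isIAEnd hx, (hγ.iaDet_eq hx).trans hr⟩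

theorem exists_detHom_val_eq {u : (CompletedGroupRing AHat)ˣ}
    (hu : aug (u : CompletedGroupRing AHat) = 1) :
    ∃ γ : IAut, ((detHom γ : (CompletedGroupRing AHat)ˣ) : CompletedGroupRing AHat) = u := by
  obtain ⟨γ, hIA, h1⟩ := exists_iaDet_eq hu
  exact ⟨⟨ContAut.ofBijective γ (hIA.bijective_of_isUnit ⟨_, h1.symm⟩), mem_iAut_iff.mpr hIA⟩, h1⟩

theorem detHom_surjective : Function.Surjective detHom := fun u =>
  (exists_detHom_val_eq (mem_specialUnits.mp u.2)).imp fun _ h => Subtype.ext (Units.ext h)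

/-- The projection from `IAut(M̂)` to `IOut(M̂)`. -/
def iOutMk : IAut →* IOut MHat :=
  ((QuotientGroup.mk' (Inn MHat)).comp IAut.subtype).codRestrict _ fun γ => γ.2

theorem iOutMk_surjective : Function.Surjective iOutMk := by
  rintro ⟨q, hq⟩
  obtain ⟨γ, rfl⟩ := QuotientGroup.mk_surjective q
  exact ⟨⟨γ, hq⟩, rfl⟩

/-- The subspace topology of `IOut(M̂)` in `Out(M̂)` is the quotient topology of `IAut(M̂)`. -/
theorem iOutMk_isQuotientMap : Topology.IsQuotientMap iOutMk := by
  have : IsOpenMap iOutMk :=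
    (QuotientGroup.isOpenMap_coe (N := Inn MHat)).restrictPreimage (IOut MHat : Set (Out MHat))
  exact this.isQuotientMap ((continuous_quot_mk.comp continuous_subtype_val).subtype_mk _)
    iOutMk_surjective

/-- The determinant of `γ` lies in `Â` exactly when `γ` is inner. -/
theorem ker_mk_detHom : (SpecialUnitsMod.mk.comp detHom).ker = iOutMk.ker := by
  ext γ
  have h1 : γ ∈ (SpecialUnitsMod.mk.comp detHom).ker ↔
      detHom γ ∈ (ofSpecial (G := AHat)).range :=
    QuotientGroup.eq_one_iff (N := (ofSpecial (G := AHat)).range) (detHom γ)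
  have h2 : γ ∈ iOutMk.ker ↔ γ.1 ∈ Inn MHat := by
    rw [MonoidHom.mem_ker, ← QuotientGroup.eq_one_iff, ← Subtype.val_inj]
    rfl
  have h3 : γ.1 ∈ Inn MHat ↔ IsInner γ.1.toEnd :=
    ⟨fun ⟨g, hg⟩ => ⟨g, hg ▸ rfl⟩, fun ⟨g, hg⟩ => ⟨g, (ContAut.toEnd_injective hg).symm⟩⟩
  refine h1.trans (Iff.trans ?_ (h2.trans (h3.trans (isIAEnd_of_iAut γ).isInner_iff)).symm)
  constructor
  · rintro ⟨a, ha⟩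
    exact ⟨a, congrArg (fun u : SpecialUnits AHat => u.1.val) ha⟩
  · rintro ⟨a, ha⟩
    exact ⟨a, Subtype.ext (Units.ext ha)⟩

theorem isClosed_iAut : IsClosed (IAut : Set (ContAut MHat)) := by
  have : (IAut : Set (ContAut MHat)) = (abAut MHat) ⁻¹' {1} := rfl
  rw [this]
  exact isClosed_singleton.preimage (continuous_abAut MHat)

theorem mk_detHom_surjective :
    Function.Surjective (SpecialUnitsMod.mk.comp detHom) :=
  (QuotientGroup.mk'_surjective _).comp detHom_surjective

/-- The isomorphism of abstract groups underlying `detBar`. -/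
def detBarEquiv : IOut MHat ≃* SpecialUnitsMod AHat :=
  (QuotientGroup.quotientKerEquivOfSurjective iOutMk iOutMk_surjective).symm.trans
    ((QuotientGroup.quotientMulEquivOfEq ker_mk_detHom.symm).trans
      (QuotientGroup.quotientKerEquivOfSurjective _ mk_detHom_surjective))

theorem detBarEquiv_mk (γ : IAut) :
    detBarEquiv (iOutMk γ) = SpecialUnitsMod.mk (detHom γ) := by
  have : (QuotientGroup.quotientKerEquivOfSurjective iOutMk iOutMk_surjective).symm (iOutMk γ) =
      QuotientGroup.mk γ := by
    rw [MulEquiv.symm_apply_eq]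
    rfl
  exact congrArg (fun q => QuotientGroup.quotientKerEquivOfSurjective _ mk_detHom_surjective
    (QuotientGroup.quotientMulEquivOfEq ker_mk_detHom.symm q)) this

theorem continuous_detBarEquiv : Continuous detBarEquiv := by
  rw [iOutMk_isQuotientMap.continuous_iff]
  have : detBarEquiv ∘ iOutMk = SpecialUnitsMod.mk ∘ detHom := funext detBarEquiv_mk
  rw [this]
  exact continuous_quot_mk.comp continuous_detHom

/-- The isomorphism of topological groups from `IOut(M̂)` to the special units modulo `Â`. -/
def detBar : IOut MHat ≃ₜ* SpecialUnitsMod AHat :=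
  have : CompactSpace IAut := isCompact_iff_compactSpace.mp isClosed_iAut.isCompact
  have : CompactSpace (IOut MHat) :=
    iOutMk_surjective.compactSpace iOutMk_isQuotientMap.continuous
  { detBarEquiv with
    continuous_toFun := continuous_detBarEquiv
    continuous_invFun :=
      (continuous_detBarEquiv.homeoOfEquivCompactToT2 (f := detBarEquiv.toEquiv)).symm.continuous }

theorem detBar_mk (γ : IAut) : detBar (iOutMk γ) = SpecialUnitsMod.mk (detHom γ) :=
  detBarEquiv_mk γ

/-! ### Profinite integers as exponents -/

section ZHatTopology

instance : CompactSpace ZHat := by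
  refine isCompact_iff_compactSpace.mp (IsClosed.isCompact ?_)
  have : (ZHat : Set (∀ n : ℕ+, ZMod n)) = ⋂ (m : ℕ+) (n : ℕ+) (h : (m : ℕ) ∣ n),
      {z | ZMod.castHom h (ZMod m) (z n) = z m} := by
    ext z
    simp only [Set.mem_iInter]
    rfl
  rw [this]
  refine isClosed_iInter fun m => isClosed_iInter fun n => isClosed_iInter fun h =>
    isClosed_eq ?_ (continuous_apply m)
  exact (continuous_of_discreteTopology (f := ZMod.castHom h (ZMod m))).comp (continuous_apply n)

theorem denseRange_intCast_zHat : DenseRange (Int.cast : ℤ → ZHat) := by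
  refine dense_iff_inter_open.mpr ?_
  rintro _ ⟨s, hs, rfl⟩ ⟨z, hz⟩
  obtain ⟨I, u, hu, hI⟩ := isOpen_pi_iff.mp hs _ hz
  let n : ℕ+ := ∏ i ∈ I, i
  obtain ⟨k, hk⟩ := ZMod.intCast_surjective (z.1 n)
  refine ⟨(k : ZHat), hI fun i hi => ?_, k, rfl⟩
  have hdvd : (i : ℕ) ∣ n := PNat.dvd_iff.mp (Finset.dvd_prod_of_mem _ hi)
  have h1 : (k : ZHat).1 i = z.1 i := by
    rw [← z.2 i n hdvd, ← hk, map_intCast]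
    rfl
  rw [h1]
  exact (hu i hi).2

/-- `Ẑ` is topologically generated by `1`. -/
theorem zHat_hom_ext {B : Type*} [AddGroup B] [TopologicalSpace B] [T2Space B] {f g : ZHat →+ B}
    (hf : Continuous f) (hg : Continuous g) (h : f 1 = g 1) : f = g := by
  refine DFunLike.coe_injective (denseRange_intCast_zHat.equalizer hf hg (funext fun k => ?_))
  change f k = g k
  have : (k : ZHat) = k • (1 : ZHat) := (zsmul_one k).symm
  rw [this, map_zsmul, map_zsmul, h]

theorem continuous_zHatToCompleted (G : Type*) [Group G] [TopologicalSpace G] :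
    Continuous (zHatToCompleted G) :=
  CompletedGroupRing.continuous_of_level fun i z => by
    have h : Continuous fun w : ZHat => w.1 i.n :=
      (continuous_apply i.n).comp continuous_subtype_val
    filter_upwards [((isOpen_discrete {z.1 i.n}).preimage h).mem_nhds rfl] with w hw
    exact congrArg (MonoidAlgebra.single 1) hw

end ZHatTopology

section ZHatPow

variable {A : Type*} [CommGroup A] [TopologicalSpace A] [IsTopologicalGroup A] [CompactSpace A]
  [TotallyDisconnectedSpace A]

theorem continuous_zHatPow (a : A) : Continuous (zHatPow a) := by
  let := trivialAction (Additive A)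
  have : ContinuousSMul Unit (Additive A) := ⟨continuous_snd⟩
  exact (continuous_act (G := Unit) (Additive.ofMul a)).comp (continuous_zHatToCompleted Unit)

theorem zHatPow_add (a : A) (z w : ZHat) : zHatPow a (z + w) = zHatPow a z * zHatPow a w := by
  let := trivialAction (Additive A)
  have : ContinuousSMul Unit (Additive A) := ⟨continuous_snd⟩
  let := completedModule (G := Unit) (V := Additive A)
  have h : (zHatToCompleted Unit (z + w)) • Additive.ofMul a =
      zHatToCompleted Unit z • Additive.ofMul a + zHatToCompleted Unit w • Additive.ofMul a := by
    rw [map_add, add_smul]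
  exact congrArg Additive.toMul h

theorem zHatPow_zero (a : A) : zHatPow a 0 = 1 := by
  simpa using zHatPow_intCast a 0

theorem zHatPow_one (a : A) : zHatPow a 1 = a := by
  simpa using zHatPow_intCast a 1

theorem map_zHatPow {B : Type*} [CommGroup B] [TopologicalSpace B] [IsTopologicalGroup B]
    [CompactSpace B] [TotallyDisconnectedSpace B] (f : A →* B) (hf : Continuous f) (a : A)
    (z : ZHat) : f (zHatPow a z) = zHatPow (f a) z := by
  let := trivialAction (Additive A)
  let := trivialAction (Additive B)
  have : ContinuousSMul Unit (Additive A) := ⟨continuous_snd⟩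
  have : ContinuousSMul Unit (Additive B) := ⟨continuous_snd⟩
  exact congrArg Additive.toMul
    (map_act (G := Unit) (MonoidHom.toAdditive f) hf (fun _ _ => rfl) (zHatToCompleted Unit z)
      (Additive.ofMul a))

end ZHatPow

/-! ### Coordinates on `Â` -/

section Coordinates

variable {x : Fin 2 → MHat}

theorem TopGenerates.exists_coord (hx : TopGenerates x) (i : Fin 2) :
    ∃ f : AHat →* Multiplicative ZHat, Continuous f ∧
      ∀ j, f (x j : AHat) = Multiplicative.ofAdd ((1 : Matrix (Fin 2) (Fin 2) ZHat) i j) := by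
  have : TotallyDisconnectedSpace (Multiplicative ZHat) :=
    inferInstanceAs (TotallyDisconnectedSpace ZHat)
  obtain ⟨f, hf⟩ := hx.exists_hom (P := Multiplicative ZHat)
    (derivedSeries_two_eq_bot (MonoidHom.id _) fun a _ b _ => mul_comm a b)
    fun j => Multiplicative.ofAdd ((1 : Matrix (Fin 2) (Fin 2) ZHat) i j)
  have hker : Derived ≤ f.toMonoidHom.ker :=
    Subgroup.topologicalClosure_minimal _ (Abelianization.commutator_subset_ker _)
      (isClosed_singleton.preimage f.continuous_toFun)
  exact ⟨QuotientGroup.lift Derived f.toMonoidHom hker,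
    continuous_quot_lift _ f.continuous_toFun, hf⟩

/-- The `i`-th coordinate on `Â` with respect to the basis given by `x`. -/
def TopGenerates.coord (hx : TopGenerates x) (i : Fin 2) : AHat →* Multiplicative ZHat :=
  (hx.exists_coord i).choose

theorem TopGenerates.continuous_coord (hx : TopGenerates x) (i : Fin 2) :
    Continuous fun a => Multiplicative.toAdd (hx.coord i a) :=
  (hx.exists_coord i).choose_spec.1

theorem TopGenerates.coord_apply (hx : TopGenerates x) (i j : Fin 2) :
    Multiplicative.toAdd (hx.coord i (x j : AHat)) = (1 : Matrix (Fin 2) (Fin 2) ZHat) i j :=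
  (hx.exists_coord i).choose_spec.2 j

theorem TopGenerates.coord_zHatPow (hx : TopGenerates x) (i : Fin 2) (a : AHat) (z : ZHat) :
    Multiplicative.toAdd (hx.coord i (zHatPow a z)) =
      z * Multiplicative.toAdd (hx.coord i a) := by
  let f : ZHat →+ ZHat :=
    { toFun := fun z => Multiplicative.toAdd (hx.coord i (zHatPow a z))
      map_zero' := by rw [zHatPow_zero, map_one, toAdd_one]
      map_add' := fun z w => by rw [zHatPow_add, map_mul, toAdd_mul] }
  have h : f = AddMonoidHom.mulRight (Multiplicative.toAdd (hx.coord i a)) :=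
    zHat_hom_ext ((hx.continuous_coord i).comp (continuous_zHatPow a))
      (continuous_mul_const _) (by
        change Multiplicative.toAdd (hx.coord i (zHatPow a 1)) = 1 * _
        rw [zHatPow_one, one_mul])
  exact DFunLike.congr_fun h z

/-- The element of `Â` with given exponents in the basis given by `x`. -/
def ofCoord (x : Fin 2 → MHat) (z : Fin 2 → ZHat) : AHat := ∏ i, zHatPow (x i : AHat) (z i)

theorem ofCoord_add (x : Fin 2 → MHat) (z w : Fin 2 → ZHat) :
    ofCoord x (z + w) = ofCoord x z * ofCoord x w := by
  simp only [ofCoord, Pi.add_apply, zHatPow_add, Finset.prod_mul_distrib]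

theorem continuous_ofCoord (x : Fin 2 → MHat) : Continuous (ofCoord x) :=
  continuous_finsetProd _ fun i _ => (continuous_zHatPow _).comp (continuous_apply i)

theorem TopGenerates.coord_ofCoord (hx : TopGenerates x) (z : Fin 2 → ZHat) (i : Fin 2) :
    Multiplicative.toAdd (hx.coord i (ofCoord x z)) = z i := by
  rw [ofCoord, map_prod, toAdd_prod]
  simp only [hx.coord_zHatPow, hx.coord_apply, Matrix.one_apply, mul_ite, mul_one, mul_zero,
    Finset.sum_ite_eq, Finset.mem_univ, if_true]

/-- The coordinates of an element of `Â`. -/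
def TopGenerates.coords (hx : TopGenerates x) (a : AHat) : Fin 2 → ZHat :=
  fun i => Multiplicative.toAdd (hx.coord i a)

theorem TopGenerates.coords_mul (hx : TopGenerates x) (a b : AHat) :
    hx.coords (a * b) = hx.coords a + hx.coords b :=
  funext fun i => by simp only [coords, map_mul, toAdd_mul, Pi.add_apply]

theorem TopGenerates.continuous_coords (hx : TopGenerates x) : Continuous hx.coords :=
  continuous_pi hx.continuous_coord

theorem TopGenerates.coords_ofCoord (hx : TopGenerates x) (z : Fin 2 → ZHat) :
    hx.coords (ofCoord x z) = z := funext (hx.coord_ofCoord z)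

theorem TopGenerates.ofCoord_coords (hx : TopGenerates x) (a : AHat) :
    ofCoord x (hx.coords a) = a := by
  let f : AHat →ₜ* AHat :=
    ⟨MonoidHom.mk' (fun a => ofCoord x (hx.coords a)) fun a b => by
      rw [hx.coords_mul, ofCoord_add], (continuous_ofCoord x).comp hx.continuous_coords⟩
  have h : f = ContinuousMonoidHom.id AHat := hx.ab.hom_ext fun j => by
    change ofCoord x (hx.coords (x j : AHat)) = (x j : AHat)
    rw [ofCoord, Finset.prod_eq_single j]
    · simp only [TopGenerates.coords, hx.coord_apply, Matrix.one_apply_eq, zHatPow_one]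
    · intro i _ hij
      simp only [TopGenerates.coords, hx.coord_apply, Matrix.one_apply_ne hij, zHatPow_zero]
    · exact fun h => absurd (Finset.mem_univ j) h
  exact DFunLike.congr_fun h a

end Coordinates

/-! ### Automorphisms of `Â` as matrices -/

section Matrices

variable {x : Fin 2 → MHat}

/-- The coordinates of `α a` are the product of the matrix of `α` with the coordinates of `a`. -/
theorem TopGenerates.coord_map (hx : TopGenerates x) (α : ContAut AHat) (a : AHat) (i : Fin 2) :
    hx.coords (α a) i = ∑ k, hx.coords (α (x k : AHat)) i * hx.coords a k := by
  conv_lhs => rw [← hx.ofCoord_coords a, ofCoord, map_prod]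
  simp only [TopGenerates.coords, map_prod, toAdd_prod]
  refine Finset.sum_congr rfl fun k _ => ?_
  have h : α (zHatPow (x k : AHat) (Multiplicative.toAdd (hx.coord k a))) =
      zHatPow (α (x k : AHat)) (Multiplicative.toAdd (hx.coord k a)) :=
    map_zHatPow α.toEnd.toMonoidHom α.toEnd.continuous_toFun _ _
  rw [h, hx.coord_zHatPow, mul_comm]

/-- The matrix of an automorphism of `Â`, as a unit of the matrix ring. -/
def TopGenerates.matrixHom (hx : TopGenerates x) :
    ContAut AHat →* Matrix.GeneralLinearGroup (Fin 2) ZHat :=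
  MonoidHom.toHomUnits
    { toFun := fun α => Matrix.of fun i j => hx.coords (α (x j : AHat)) i
      map_one' := by
        ext i j : 1
        exact hx.coord_apply i j
      map_mul' := fun α β => by
        ext i j : 1
        exact hx.coord_map α (β (x j : AHat)) i }

theorem TopGenerates.matrixHom_apply (hx : TopGenerates x) (α : ContAut AHat) (i j : Fin 2) :
    (hx.matrixHom α : Matrix (Fin 2) (Fin 2) ZHat) i j = hx.coords (α (x j : AHat)) i := rfl

theorem TopGenerates.apply_eq_ofCoord (hx : TopGenerates x) (α : ContAut AHat) (j : Fin 2) :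
    α (x j : AHat) = ∏ i, zHatPow (x i : AHat)
      ((hx.matrixHom α : Matrix (Fin 2) (Fin 2) ZHat) i j) :=
  (hx.ofCoord_coords _).symm

theorem TopGenerates.matrixHom_injective (hx : TopGenerates x) :
    Function.Injective hx.matrixHom := by
  intro α β h
  refine ContAut.toEnd_injective (hx.ab.hom_ext fun j => ?_)
  exact (hx.apply_eq_ofCoord α j).trans (h ▸ (hx.apply_eq_ofCoord β j).symm)

theorem TopGenerates.matrixHom_surjective (hx : TopGenerates x) :
    Function.Surjective hx.matrixHom := by
  intro g
  let f : Matrix (Fin 2) (Fin 2) ZHat → AHat → AHat := fun A a =>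
    ofCoord x (A.mulVec (hx.coords a))
  have hf : ∀ A B : Matrix (Fin 2) (Fin 2) ZHat, A * B = 1 → ∀ a, f A (f B a) = a := by
    intro A B h a
    simp only [f, hx.coords_ofCoord, Matrix.mulVec_mulVec, h, Matrix.one_mulVec,
      hx.ofCoord_coords]
  have hc : ∀ A, Continuous (f A) := fun A =>
    (continuous_ofCoord x).comp (continuous_const.matrix_mulVec hx.continuous_coords)
  let α : ContAut AHat :=
    ({ toFun := f g.val
       invFun := f g⁻¹.val
       left_inv := hf _ _ g.inv_mul
       right_inv := hf _ _ g.mul_inv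
       map_mul' := fun a b => by
         simp only [f, hx.coords_mul, Matrix.mulVec_add, ofCoord_add]
       continuous_toFun := hc _
       continuous_invFun := hc _ } : AHat ≃ₜ* AHat)
  refine ⟨α, Units.ext (Matrix.ext fun i j => ?_)⟩
  rw [hx.matrixHom_apply]
  change hx.coords (ofCoord x (g.val.mulVec (hx.coords (x j : AHat)))) i = _
  have h1 : hx.coords (x j : AHat) = Pi.single j 1 := funext fun k => by
    rw [TopGenerates.coords, hx.coord_apply, Matrix.one_apply, Pi.single_apply]
  rw [hx.coords_ofCoord, h1, Matrix.mulVec_single_one]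
  rfl

theorem TopGenerates.continuous_matrixHom (hx : TopGenerates x) : Continuous hx.matrixHom := by
  have : CompactSpace (Matrix (Fin 2) (Fin 2) ZHat) :=
    inferInstanceAs (CompactSpace (Fin 2 → Fin 2 → ZHat))
  refine isClosedEmbedding_units_val.continuous_iff.mpr (continuous_matrix fun i j => ?_)
  exact (hx.continuous_coord i).comp (ContAut.continuous_apply (x j : AHat))

/-- Every automorphism `α` of `Â` lifts to `M̂`: by Gaschütz's lemma, the generators `α aⱼ` of `Â`
lift to generators of `M̂`. -/
theorem abAut_surjective : Function.Surjective (abAut MHat) := by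
  intro α
  have hx := topGenerates_stdGen
  choose b hb using fun j => QuotientGroup.mk_surjective (α (stdGen j : AHat))
  have hgen : TopGenerates fun j => (b j : AHat) := by
    have := hx.ab.map α.toEnd.toMonoidHom α.toEnd.continuous_toFun (EquivLike.surjective α)
    rwa [show (fun j => (b j : AHat)) = fun j => α (stdGen j : AHat) from funext hb]
  obtain ⟨y, hy, hyb⟩ := hx.exists_lift Derived (Subgroup.isClosed_topologicalClosure _) b hgen
  have hs : Function.Surjective (endo y) := hy.surjective _ fun i => ⟨stdGen i, endo_stdGen y i⟩
  refine ⟨ContAut.ofBijective (endo y) ⟨hx.injective_of_surjective _ hs, hs⟩,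
    ContAut.toEnd_injective (hx.ab.hom_ext fun j => ?_)⟩
  change ((endo y (stdGen j) : MHat) : AHat) = α (stdGen j : AHat)
  rw [endo_stdGen, hyb, hb]

instance : CompactSpace (ContAut AHat) := abAut_surjective.compactSpace (continuous_abAut MHat)

/-- The identification of the automorphism group of `Â` with `GL₂(Ẑ)`. -/
def TopGenerates.matrixEquiv (hx : TopGenerates x) :
    ContAut AHat ≃ₜ* Matrix.GeneralLinearGroup (Fin 2) ZHat :=
  let e := MulEquiv.ofBijective hx.matrixHom ⟨hx.matrixHom_injective, hx.matrixHom_surjective⟩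
  have hc : Continuous e := hx.continuous_matrixHom
  { e with
    continuous_toFun := hc
    continuous_invFun := (hc.homeoOfEquivCompactToT2 (f := e.toEquiv)).symm.continuous }

end Matrices

end ProMetabelian

end

theorem mainTheorem3 :
    (∀ x : Fin 2 → MHat, TopGenerates x →
      (∀ r : Fin 2 → CompletedGroupRing AHat, ∃! γ : MHat →ₜ* MHat, IsGamma x r γ) ∧
      (∀ (r : Fin 2 → CompletedGroupRing AHat) (γ : MHat →ₜ* MHat),
        IsGamma x r γ → IsIAEnd γ) ∧
      (∀ γ : MHat →ₜ* MHat, IsIAEnd γ →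
        ∃! r : Fin 2 → CompletedGroupRing AHat, IsGamma x r γ) ∧
      (∀ (r : Fin 2 → CompletedGroupRing AHat) (γ : MHat →ₜ* MHat), IsGamma x r γ →
        (IsInner γ ↔ bachmuthDet x r ∈ Set.range (of : AHat → CompletedGroupRing AHat)))) ∧
    ∃ detBar : IOut MHat ≃ₜ* SpecialUnitsMod AHat,
      (∀ x : Fin 2 → MHat, TopGenerates x →
        ∀ (r : Fin 2 → CompletedGroupRing AHat) (γ : ContAut MHat)
          (hγ : (QuotientGroup.mk γ : Out MHat) ∈ IOut MHat), IsGamma x r γ.toEnd →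
          ∃ u : SpecialUnits AHat, ((u : (CompletedGroupRing AHat)ˣ) : CompletedGroupRing AHat) =
              bachmuthDet x r ∧
            detBar ⟨QuotientGroup.mk γ, hγ⟩ = SpecialUnitsMod.mk u) ∧
      Continuous (abStar MHat) ∧
      ∀ x : Fin 2 → MHat, TopGenerates x →
        ∃ e : ContAut AHat ≃ₜ* Matrix.GeneralLinearGroup (Fin 2) ZHat,
          (∀ (α : ContAut AHat) (j : Fin 2), α (QuotientGroup.mk (x j) : AHat) =
            ∏ i : Fin 2, zHatPow (QuotientGroup.mk (x i) : AHat)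
              ((e α : Matrix (Fin 2) (Fin 2) ZHat) i j)) ∧
          Function.Injective ((IOut MHat).subtype.comp detBar.symm.toMulEquiv.toMonoidHom) ∧
          ((IOut MHat).subtype.comp detBar.symm.toMulEquiv.toMonoidHom).range =
            (e.toMulEquiv.toMonoidHom.comp (abStar MHat)).ker ∧
          Function.Surjective (e.toMulEquiv.toMonoidHom.comp (abStar MHat)) := by
  refine ⟨fun x hx => ⟨fun r => ?_, fun r γ h => h.isIAEnd hx, fun γ h => ?_, fun r γ h => ?_⟩,
    detBar, ?_, continuous_abStar MHat,
    fun x hx => ⟨hx.matrixEquiv, hx.apply_eq_ofCoord, ?_, ?_, ?_⟩⟩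
  · obtain ⟨γ, hγ⟩ := hx.exists_isGamma r
    exact ⟨γ, hγ, fun δ hδ => hx.hom_ext fun i => (hδ i).trans (hγ i).symm⟩
  · obtain ⟨r, hr⟩ := h.exists_isGamma hx
    exact ⟨r, hr, fun s hs => hs.unique hx hr⟩
  · rw [← h.iaDet_eq hx]
    exact (h.isIAEnd hx).isInner_iff
  · intro x hx r γ hγ h
    exact ⟨detHom ⟨γ, hγ⟩, h.iaDet_eq hx, detBar_mk ⟨γ, hγ⟩⟩
  · exact (Subgroup.subtype_injective _).comp detBar.symm.injective
  · have h1 : ((IOut MHat).subtype.comp detBar.symm.toMulEquiv.toMonoidHom).range = IOut MHat := by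
      rw [MonoidHom.range_comp, MonoidHom.range_eq_top.mpr detBar.symm.surjective,
        ← MonoidHom.range_eq_map, Subgroup.range_subtype]
    rw [h1, IOut]
    exact (MonoidHom.ker_mulEquiv_comp _ hx.matrixEquiv.toMulEquiv).symm
  · refine hx.matrixEquiv.surjective.comp fun α => ?_
    obtain ⟨γ, hγ⟩ := abAut_surjective α
    exact ⟨QuotientGroup.mk γ, hγ⟩
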